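/- **Setting.** Let $\Omega\subset\mathbb{R}^2$ be a bounded connected polygonal domain with Lipschitz boundary and outward unit normal $\mathbf n=(n_1,n_2)$; points are written $(x,y)$. Put $$\partial_-\Omega=\{(x,y)\in\partial\Omega: n_1=0,\ xn_2<0\},\qquad \partial_+\Omega=\{(x,y)\in\partial\Omega: n_1=0,\ xn_2\ge 0\},$$ and assume that $\partial_-\Omega$ has positive one-dimensional Hausdorff measure. A triangulation $\mathcal T$ of $\Omega$ is a finite set of mutually disjoint open triangles whose closures cover $\overline\Omega$ exactly. For $T\in\mathcal T$ let $h_T=\operatorname{diam}T$, let $\rho_T$ be the radius of the largest circle inscribed in $T$, let $\partial_-T$ and $\partial_+T$ be the parts of $\partial T$ with $xn_2<0$ and $xn_2\ge0$, where $\mathbf n$ is the outward normal of $T$, and let $h_{\min}=\min_T h_T$, $h_{\max}=\max_T h_T$. The triangulation is shape-regular with constant $\sigma>0$ if $\rho_T\ge\sigma h_T$ for all $T\in\mathcal T$. Let $C_{inv},C_{INV}>0$ be constants (in the finite element method: constants, depending only on $\sigma$, of the inverse inequalities $\|v\|_{\partial T}\le C_{inv}\,p\,h_T^{-1/2}\|v\|_T$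 and $\|\nabla v\|_T\le C_{INV}\,p^2h_T^{-1}\|v\|_T$ for polynomials $v$ of degree at most $p$; the result holds for any positive values). For an integer $p\ge1$ set, on each $T\in\mathcal T$, $$\delta=C_\delta^T\frac{p^4}{h_T^2},\qquad C_\delta^T=\frac{C_{inv}^2}{6}\bigl(3\|xn_2\|_{L_\infty(\partial_-T)}+2\|n_1\|_{L_\infty(\partial T)}^2\bigr),\qquad \tau=\frac{h_T^2}{4C_{INV}^2p^4},$$ $$\alpha=\frac1{8\delta},\qquad \beta=\frac1{24\delta^2},\qquad \gamma=\frac1{64\delta^3},\qquad A=\begin{pmatrix}\alpha&\beta\\ \beta&\gamma\end{pmatrix}.$$ With $\|\cdot\|_\omega$ the $L_2(\omega)$-norm, $\|\cdot\|=\|\cdot\|_\Omega$, $H^2(\Omega,\mathcal T)$ the functions that are in $H^2(T)$ for every $T\in\mathcal T$, $\nabla_{\mathcal T}$ the elementwise gradient, and boundary values understood as traces (on $\partial_+T$, from inside $T$), define $$\|w\|_A^2=\|w\|^2+\|\sqrt A\,\nabla w\|^2,$$ $$|||w|||^2=\tfrac12\|w_x\|^2+\|\sqrt{\gamma\delta}\,w_y\|^2+\tfrac12\|\sqrt\tau\,(w_t+xw_y)\|^2+\|\sqrt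 A\,\nabla_{\mathcal T}w_x\|^2+\|\sqrt{xn_2}\,w\|^2_{\partial_+\Omega}+\sum_{T\in\mathcal T}\|\sqrt{xn_2A}\,\nabla w\|^2_{\partial_+T}.$$ **Lemma (mesh-dependent spectral gap).** There is a constant $0<c_{\rm hc}<1$, depending only on $\Omega$, $\sigma$ and $C_{inv}$ (in particular independent of the mesh and of $p$), such that for every triangulation $\mathcal T$ of $\Omega$ that is shape-regular with constant $\sigma$ and satisfies $h_{\max}<1$, every integer $p\ge1$, every time interval $I=(0,t_f]$ with $t_f>0$, and every $w\in H^1(I;H^1(\Omega)\cap H^2(\Omega,\mathcal T))$ with $w=0$ on $\partial_-\Omega$, $$|||w(t)|||^2\ \ge\ \kappa\,\|w(t)\|_A^2\quad\text{for almost every }t\in I,\qquad\text{with }\ \kappa=c_{\rm hc}\,h_{\min}^4\,p^{-8}.$$ -/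

import Mathlib

open MeasureTheory Set
open scoped ContDiff ENNReal

namespace Kolmogorov

noncomputable section

/-- The plane with its Euclidean norm; the coordinates `z 0`, `z 1` of a point are `x`, `y`. -/
abbrev Plane := EuclideanSpace ℝ (Fin 2)

/-! ### Polygonal domains, outward normals, parts of the boundary -/

/-- The open circular sector with vertex `z`, radius `r`, and directions in `(θ, θ + η)`. -/
def sector (z : Plane) (r θ η : ℝ) : Set Plane :=
  {ζ | ∃ ρ ∈ Ioo 0 r, ∃ φ ∈ Ioo θ (θ + η), ζ = z + ρ • !₂[Real.cos φ, Real.sin φ]}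

/-- Bounded polygonal domains with Lipschitz boundary: near each boundary point the domain is a
sector with opening in `(0, 2π)` (opening `π` at the interior points of the sides). -/
structure IsPolygonalDomain (Ω : Set Plane) : Prop where
  isOpen : IsOpen Ω
  isConnected : IsConnected Ω
  isBounded : Bornology.IsBounded Ω
  locally_sector : ∀ z ∈ frontier Ω, ∃ r θ η : ℝ, 0 < r ∧ 0 < η ∧ η < 2 * Real.pi ∧
    Ω ∩ Metric.ball z r = sector z r θ η

/-- `n` is the outward unit normal of `U` at the boundary point `z`, for sets `U` with polygonal
boundary: near `z`, the set `U` is the half-plane `⟨ζ - z, n⟩ < 0`.  It exists at every boundary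
point of a polygon that is not a corner, and it is unique. -/
def IsOutwardNormal (U : Set Plane) (z n : Plane) : Prop :=
  z ∈ frontier U ∧ ‖n‖ = 1 ∧
    ∃ r > 0, ∀ ζ ∈ Metric.ball z r, ζ ∈ U ↔ inner ℝ (ζ - z) n < 0

open Classical in
/-- The outward unit normal field on the boundary of `U` (zero where there is none). -/
def outwardNormal (U : Set Plane) (z : Plane) : Plane :=
  if h : ∃ n, IsOutwardNormal U z n then h.choose else 0

/-- The inflow part `∂₋Ω`: the points of the boundary with `n₁ = 0` and `x n₂ < 0`. -/
def inflow (Ω : Set Plane) : Set Plane :=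
  {z | ∃ n, IsOutwardNormal Ω z n ∧ n 0 = 0 ∧ z 0 * n 1 < 0}

/-- The outflow part `∂₊Ω`: the points of the boundary with `n₁ = 0` and `x n₂ ≥ 0`. -/
def outflow (Ω : Set Plane) : Set Plane :=
  {z | ∃ n, IsOutwardNormal Ω z n ∧ n 0 = 0 ∧ 0 ≤ z 0 * n 1}

/-- `∂₋T` for an element `T`: the points of the boundary with `x n₂ < 0`. -/
def elemInflow (T : Set Plane) : Set Plane :=
  {z | ∃ n, IsOutwardNormal T z n ∧ z 0 * n 1 < 0}

/-- `∂₊T` for an element `T`: the points of the boundary with `x n₂ ≥ 0`. -/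
def elemOutflow (T : Set Plane) : Set Plane :=
  {z | ∃ n, IsOutwardNormal T z n ∧ 0 ≤ z 0 * n 1}

/-! ### Triangulations -/

/-- Nondegenerate open triangles. -/
def IsOpenTriangle (T : Set Plane) : Prop :=
  ∃ v : Fin 3 → Plane, AffineIndependent ℝ v ∧ T = interior (convexHull ℝ (range v))

/-- Triangulations: mutually disjoint open triangles whose closures cover the closure of `Ω`
exactly. -/
structure IsTriangulation (Ω : Set Plane) (𝒯 : Finset (Set Plane)) : Prop where
  isOpenTriangle : ∀ T ∈ 𝒯, IsOpenTriangle T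
  disjoint : ∀ T ∈ 𝒯, ∀ T' ∈ 𝒯, T ≠ T' → Disjoint T T'
  cover : ⋃ T ∈ 𝒯, closure T = closure Ω

/-- The radius of the largest circle inscribed in `T`. -/
def inradius (T : Set Plane) : ℝ :=
  sSup {r : ℝ | 0 ≤ r ∧ ∃ c, Metric.ball c r ⊆ T}

/-- Shape-regularity with constant `σ`: `ρ_T ≥ σ h_T` on every element, where `h_T = diam T`. -/
def IsShapeRegular (σ : ℝ) (𝒯 : Finset (Set Plane)) : Prop :=
  ∀ T ∈ 𝒯, σ * Metric.diam T ≤ inradius T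

/-- The largest meshsize. -/
def hMax (𝒯 : Finset (Set Plane)) : ℝ := ⨆ T : 𝒯, Metric.diam (T : Set Plane)

/-- The smallest meshsize. -/
def hMin (𝒯 : Finset (Set Plane)) : ℝ := ⨅ T : 𝒯, Metric.diam (T : Set Plane)

/-! ### Weak derivatives, traces, function spaces -/

/-- The classical partial derivative `∂ᵢ φ`. -/
def partialDeriv (i : Fin 2) (φ : Plane → ℝ) (z : Plane) : ℝ :=
  fderiv ℝ φ z (EuclideanSpace.single i 1)

/-- `v` is the weak partial derivative `∂ᵢ u` on the open set `U` (for `u`, `v` in `L₂(U)`). -/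
def HasWeakPartial (U : Set Plane) (i : Fin 2) (u v : Plane → ℝ) : Prop :=
  ∀ φ : Plane → ℝ, ContDiff ℝ ∞ φ → HasCompactSupport φ → tsupport φ ⊆ U →
    ∫ z in U, u z * partialDeriv i φ z = - ∫ z in U, v z * φ z

/-- One-dimensional Hausdorff measure (arc length) on the boundary of `U`. -/
def bdry (U : Set Plane) : Measure Plane := (Measure.hausdorffMeasure 1).restrict (frontier U)

/-- `g` is the trace on the boundary of `U` of the function `u` in `H¹(U)` with weak gradient
`Du`: it is in `L₂(∂U)` and Green's formula holds with boundary values `g`. -/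
def IsTrace (U : Set Plane) (u : Plane → ℝ) (Du : Fin 2 → Plane → ℝ) (g : Plane → ℝ) : Prop :=
  MemLp g 2 (bdry U) ∧
    ∀ φ : Plane → ℝ, ContDiff ℝ ∞ φ → HasCompactSupport φ → ∀ i : Fin 2,
      ∫ z in U, (Du i z * φ z + u z * partialDeriv i φ z)
        = ∫ z, g z * φ z * outwardNormal U z i ∂(bdry U)

open Classical in
/-- The trace on the boundary of `U` of the function `u` in `H¹(U)` with weak gradient `Du`. -/
def trace (U : Set Plane) (u : Plane → ℝ) (Du : Fin 2 → Plane → ℝ) : Plane → ℝ :=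
  if h : ∃ g, IsTrace U u Du g then h.choose else 0

/-- Labels of the derivatives up to second order: `u`, `∂ᵢ u`, and `∂ⱼ ∂ᵢ u` for `(i, j)`. -/
abbrev JetIndex := Unit ⊕ (Fin 2 ⊕ (Fin 2 × Fin 2))

/-- Families `(u, ∂ᵢ u, ∂ⱼ ∂ᵢ u)` of functions in `L₂(Ω)`, with the Hilbert norm.  A function in
`H¹(Ω) ∩ H²(Ω, 𝒯)` is identified with the family of its derivatives, so that the norm of this
Hilbert space is the norm of `H¹(Ω) ∩ H²(Ω, 𝒯)`. -/
abbrev Jet (Ω : Set Plane) := PiLp 2 fun _ : JetIndex => Lp ℝ 2 (volume.restrict Ω)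

/-- The function itself. -/
def val {Ω : Set Plane} (u : Jet Ω) : Plane → ℝ := u (Sum.inl ())

/-- Its first partial derivatives. -/
def grad {Ω : Set Plane} (u : Jet Ω) (i : Fin 2) : Plane → ℝ := u (Sum.inr (Sum.inl i))

/-- Its elementwise second partial derivatives `∂ⱼ ∂ᵢ u`. -/
def hess {Ω : Set Plane} (u : Jet Ω) (i j : Fin 2) : Plane → ℝ := u (Sum.inr (Sum.inr (i, j)))

/-- The space `H¹(Ω) ∩ H²(Ω, 𝒯)`. -/
def H1BrokenH2 (Ω : Set Plane) (𝒯 : Finset (Set Plane)) : Set (Jet Ω) :=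
  {u | (∀ i, HasWeakPartial Ω i (val u) (grad u i)) ∧
    ∀ T ∈ 𝒯, ∀ i j, HasWeakPartial T j (grad u i) (hess u i j)}

/-- `u = 0` on the inflow boundary, in the sense of traces. -/
def VanishesOnInflow {Ω : Set Plane} (u : Jet Ω) : Prop :=
  ∃ g, IsTrace Ω (val u) (grad u) g ∧ ∀ᵐ z ∂(bdry Ω), z ∈ inflow Ω → g z = 0

/-- `w ∈ H¹(I; V)`, `I = (0, tf]`, with weak time derivative `w'`, for a closed subspace `V` of a
Hilbert space `X`: both are in `L₂(I; V)`, and `w' = w_t` in the sense of distributions. -/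
structure IsH1Time {X : Type*} [NormedAddCommGroup X] [NormedSpace ℝ X] (tf : ℝ) (V : Set X)
    (w w' : ℝ → X) : Prop where
  memLp : MemLp w 2 (volume.restrict (Ioc 0 tf))
  memLp_deriv : MemLp w' 2 (volume.restrict (Ioc 0 tf))
  mem : ∀ᵐ t ∂(volume.restrict (Ioc 0 tf)), w t ∈ V
  mem_deriv : ∀ᵐ t ∂(volume.restrict (Ioc 0 tf)), w' t ∈ V
  weak_deriv : ∀ φ : ℝ → ℝ, ContDiff ℝ ∞ φ → HasCompactSupport φ → tsupport φ ⊆ Ioo 0 tf →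
    ∫ t in Ioc 0 tf, deriv φ t • w t = - ∫ t in Ioc 0 tf, φ t • w' t

/-! ### The parameters of the method -/

/-- `C_δ^T = (C_inv² / 6) (3 ‖x n₂‖_{L∞(∂₋T)} + 2 ‖n₁‖²_{L∞(∂T)})`. -/
def cDelta (Cinv : ℝ) (T : Set Plane) : ℝ :=
  Cinv ^ 2 / 6 *
    (3 * (eLpNorm (fun z : Plane => z 0 * outwardNormal T z 1) ∞
        ((bdry T).restrict (elemInflow T))).toReal
      + 2 * (eLpNorm (fun z => outwardNormal T z 0) ∞ (bdry T)).toReal ^ 2)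

/-- `δ_T = C_δ^T p⁴ / h_T²`. -/
def delta (Cinv : ℝ) (p : ℕ) (T : Set Plane) : ℝ :=
  cDelta Cinv T * (p : ℝ) ^ 4 / Metric.diam T ^ 2

/-- `τ_T = h_T² / (4 C_INV² p⁴)`. -/
def tau (CINV : ℝ) (p : ℕ) (T : Set Plane) : ℝ :=
  Metric.diam T ^ 2 / (4 * CINV ^ 2 * (p : ℝ) ^ 4)

/-- `α = (8 δ)⁻¹`. -/
def alpha (δ : ℝ) : ℝ := (8 * δ)⁻¹

/-- `β = (24 δ²)⁻¹`. -/
def beta (δ : ℝ) : ℝ := (24 * δ ^ 2)⁻¹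

/-- `γ = (64 δ³)⁻¹`. -/
def gamma (δ : ℝ) : ℝ := (64 * δ ^ 3)⁻¹

/-- The matrix `A` with rows `(α, β)` and `(β, γ)`. -/
def matA (δ : ℝ) : Matrix (Fin 2) (Fin 2) ℝ := !![alpha δ, beta δ; beta δ, gamma δ]

/-- `|√A v|² = (A v) · v`. -/
def quadA (δ : ℝ) (v : Fin 2 → ℝ) : ℝ := (matA δ).mulVec v ⬝ᵥ v

/-! ### The two norms -/

/-- `‖w‖_A² = ‖w‖² + (∇w, A ∇w)`, with `A` constant on each element. -/
def normASq {Ω : Set Plane} (𝒯 : Finset (Set Plane)) (Cinv : ℝ) (p : ℕ) (w : Jet Ω) : ℝ :=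
  (∫ z in Ω, val w z ^ 2)
    + ∑ T ∈ 𝒯, ∫ z in T, quadA (delta Cinv p T) (fun i => grad w i z)

/-- The square of the stabilisation norm at a given time, for a function with value `w` and time
derivative `wt` at that time:
`½ ‖w_x‖² + ‖√(γδ) w_y‖² + ½ ‖√τ (w_t + x w_y)‖² + ‖√A ∇_𝒯 w_x‖²
  + ‖√(x n₂) w‖²_{∂₊Ω} + ∑_T ‖√(x n₂ A) ∇w‖²_{∂₊T}`. -/
def stabNormSq {Ω : Set Plane} (𝒯 : Finset (Set Plane)) (Cinv CINV : ℝ) (p : ℕ)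
    (w wt : Jet Ω) : ℝ :=
  1 / 2 * (∫ z in Ω, grad w 0 z ^ 2)
    + (∑ T ∈ 𝒯, gamma (delta Cinv p T) * delta Cinv p T * (∫ z in T, grad w 1 z ^ 2))
    + 1 / 2 * (∑ T ∈ 𝒯, tau CINV p T * (∫ z in T, (val wt z + z 0 * grad w 1 z) ^ 2))
    + (∑ T ∈ 𝒯, (∫ z in T, quadA (delta Cinv p T) (fun j => hess w 0 j z)))
    + (∫ z, (outflow Ω).indicator
        (fun z => z 0 * outwardNormal Ω z 1 * trace Ω (val w) (grad w) z ^ 2) z ∂(bdry Ω))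
    + (∑ T ∈ 𝒯, (∫ z, (elemOutflow T).indicator
        (fun z => z 0 * outwardNormal T z 1 *
          quadA (delta Cinv p T) (fun i => trace T (grad w i) (hess w i) z)) z ∂(bdry T)))

end

end Kolmogorov

namespace Kolmogorov

/-! ### Translation estimates for weakly differentiable functions -/

/-! Both sides are compared with `‖∇w‖²` at a fixed time. In the stabilisation norm only `½‖w_x‖²`
and `‖√(γδ) w_y‖²` are used; every other term is nonnegative. Since `γδ = 1/(64δ²)` and `δ ≤ b
p⁴/h_T²` with `b` depending on `Ω` and `C_inv` (`cDelta_le`), these two terms dominate a multiple of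
`h_min⁴ p⁻⁸ ‖∇w‖²`. This is the origin of the rate (`gamma_mul_delta_ge`, `le_stabNormSq`).

Conversely `‖w‖_A² ≤ K‖∇w‖²`. For the part with `A`, shape-regularity, `h_T < 1` and `p ≥ 1` keep
`δ` away from zero (`le_cDelta`, `le_delta`), so `A` is bounded. For `‖w‖²` a Friedrichs inequality
is needed (`friedrichs`), because `w` vanishes on the inflow boundary.

The Friedrichs inequality is proved by propagation, without compact embeddings. Translating by `h`
changes `u` in `L²` by at most `‖h‖ ‖∇u‖` (`integral_translate_sub_sq_le`). Hence a local bound near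
`z + h` yields one near `z` if the segments stay in the domain. Near an inflow point the extension
by zero starts the process, connectedness carries it through `Ω`, sectors carry it to the boundary,
and compactness of the closure makes the constant uniform. -/

lemma norm_toLp_sq {X : Type*} [MeasurableSpace X] {μ : Measure X} {f : X → ℝ}
    (hf : MemLp f 2 μ) : ‖hf.toLp f‖ ^ 2 = ∫ x, f x ^ 2 ∂μ := by
  rw [← real_inner_self_eq_norm_sq, L2.inner_def]
  refine integral_congr_ae ?_
  filter_upwards [hf.coeFn_toLp] with x hx
  simp [hx, pow_two]

lemma inner_toLp {X : Type*} [MeasurableSpace X] {μ : Measure X} {f g : X → ℝ}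
    (hf : MemLp f 2 μ) (hg : MemLp g 2 μ) :
    inner ℝ (hf.toLp f) (hg.toLp g) = ∫ x, f x * g x ∂μ := by
  rw [L2.inner_def]
  refine integral_congr_ae ?_
  filter_upwards [hf.coeFn_toLp, hg.coeFn_toLp] with x hx hx'
  simp [hx, hx', mul_comm]

lemma norm_toLp_eq_sqrt {X : Type*} [MeasurableSpace X] {μ : Measure X} {f : X → ℝ}
    (hf : MemLp f 2 μ) : ‖hf.toLp f‖ = √(∫ x, f x ^ 2 ∂μ) := by
  rw [← norm_toLp_sq hf, Real.sqrt_sq (norm_nonneg _)]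

lemma abs_integral_mul_le {X : Type*} [MeasurableSpace X] {μ : Measure X} {f g : X → ℝ}
    (hf : MemLp f 2 μ) (hg : MemLp g 2 μ) :
    |∫ x, f x * g x ∂μ| ≤ √(∫ x, f x ^ 2 ∂μ) * √(∫ x, g x ^ 2 ∂μ) := by
  rw [← inner_toLp hf hg, ← norm_toLp_eq_sqrt hf, ← norm_toLp_eq_sqrt hg]
  exact abs_real_inner_le_norm _ _

lemma fderiv_eq_sum_partialDeriv (φ : Plane → ℝ) (z h : Plane) :
    fderiv ℝ φ z h = ∑ i, h i * partialDeriv i φ z := by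
  have : h = ∑ i, h i • EuclideanSpace.single i (1 : ℝ) := by
    ext j; fin_cases j <;> simp
  conv_lhs => rw [this]
  simp [partialDeriv]

lemma continuous_partialDeriv {φ : Plane → ℝ} (hφ : ContDiff ℝ ∞ φ) (i : Fin 2) :
    Continuous (partialDeriv i φ) :=
  (hφ.continuous_fderiv (by simp)).clm_apply continuous_const

lemma hasCompactSupport_partialDeriv {φ : Plane → ℝ} (hφ : HasCompactSupport φ) (i : Fin 2) :
    HasCompactSupport (partialDeriv i φ) :=
  hφ.fderiv_apply (𝕜 := ℝ) (EuclideanSpace.single i 1)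

lemma tsupport_partialDeriv_subset (φ : Plane → ℝ) (i : Fin 2) :
    tsupport (partialDeriv i φ) ⊆ tsupport φ :=
  tsupport_fderiv_apply_subset ℝ (EuclideanSpace.single i 1)

lemma partialDeriv_comp_sub (φ : Plane → ℝ) (a z : Plane) (i : Fin 2) :
    partialDeriv i (fun x => φ (x - a)) z = partialDeriv i φ (z - a) := by
  simp [partialDeriv, fderiv_comp_sub]

/-- The translation is put on the test function: `s ↦ ∫ u φ(· - s h)` is differentiable for any `L²`
function `u`, and the weak gradient enters only in rewriting its derivative as `∫ (h · v) φ(· - s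
h)`. The mean value inequality on `[0, 1]` and Cauchy–Schwarz conclude. -/
lemma abs_integral_translate_sub_le {U W : Set Plane} (hfin : volume U ≠ ⊤)
    {u : Plane → ℝ} {v : Fin 2 → Plane → ℝ} (hu : MemLp u 2 (volume.restrict U))
    (hv : ∀ i, MemLp (v i) 2 (volume.restrict U)) (hw : ∀ i, HasWeakPartial U i u (v i))
    (h : Plane) (hWU : ∀ x ∈ W, ∀ s ∈ Icc (0 : ℝ) 1, x + s • h ∈ U) {φ : Plane → ℝ}
    (hφ : ContDiff ℝ ∞ φ) (hφc : HasCompactSupport φ) (hφW : tsupport φ ⊆ W) :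
    |(∫ z in U, u z * φ (z - h)) - ∫ z in U, u z * φ z|
      ≤ √(∫ z in U, (∑ i, h i * v i z) ^ 2) * √(∫ z, φ z ^ 2) := by
  have : IsFiniteMeasure (volume.restrict U) := ⟨by simpa using hfin.lt_top⟩
  have hu1 : Integrable u (volume.restrict U) := hu.integrable (by norm_num)
  have hcs : ∀ s : ℝ, ContDiff ℝ ∞ (fun z => φ (z - s • h)) := fun s =>
    hφ.comp (contDiff_id.sub contDiff_const)
  have hcc : ∀ s : ℝ, HasCompactSupport (fun z => φ (z - s • h)) := fun s => by
    have := hφc.comp_homeomorph (Homeomorph.subRight (s • h))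
    exact this
  -- The condition on segments keeps the support of every intermediate translate inside `U`, so it
  -- is admissible in the definition of the weak derivative.
  have hts : ∀ s ∈ Icc (0 : ℝ) 1, tsupport (fun z => φ (z - s • h)) ⊆ U := by
    intro s hs z hz
    have h1 : z - s • h ∈ tsupport φ :=
      tsupport_comp_subset_preimage φ (f := fun z : Plane => z - s • h) (by fun_prop) hz
    simpa using hWU _ (hφW h1) s hs
  have hφL : ∀ s : ℝ, MemLp (fun z => φ (z - s • h)) 2 (volume.restrict U) := fun s =>
    ((hcs s).continuous.memLp_of_hasCompactSupport (hcc s)).restrict U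
  have hφs : ∀ s : ℝ, (∫ z in U, φ (z - s • h) ^ 2) ≤ ∫ z, φ z ^ 2 := by
    intro s
    rw [← integral_sub_right_eq_self (fun z => φ z ^ 2) (s • h)]
    refine setIntegral_le_integral ?_ (Filter.Eventually.of_forall fun z => sq_nonneg _)
    exact ((hcs s).continuous.memLp_of_hasCompactSupport (p := 2) (hcc s)).integrable_sq
  have hVL : MemLp (fun z => ∑ i, h i * v i z) 2 (volume.restrict U) :=
    memLp_finsetSum _ fun i _ => (hv i).const_mul (h i)
  obtain ⟨M, hM⟩ : ∃ M, ∀ z, ‖fderiv ℝ φ z h‖ ≤ M := by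
    have hc : Continuous fun z => fderiv ℝ φ z h :=
      (hφ.continuous_fderiv (by simp)).clm_apply continuous_const
    exact hc.bounded_above_of_compact_support (hφc.fderiv_apply (𝕜 := ℝ) h)
  have hder : ∀ s : ℝ, HasDerivAt (fun s : ℝ => ∫ z in U, u z * φ (z - s • h))
      (∫ z in U, u z * -(fderiv ℝ φ (z - s • h) h)) s := by
    intro s
    refine (hasDerivAt_integral_of_dominated_loc_of_deriv_le (s := univ)
      (F := fun (s : ℝ) z => u z * φ (z - s • h))
      (F' := fun (s : ℝ) z => u z * -(fderiv ℝ φ (z - s • h) h))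
      (bound := fun z => ‖u z‖ * M) Filter.univ_mem ?_ ?_ ?_ ?_ ?_ ?_).2
    · exact Filter.Eventually.of_forall fun s =>
        hu.1.mul (hcs s).continuous.aestronglyMeasurable
    · exact hu.integrable_mul (hφL s)
    · refine hu.1.mul (Continuous.aestronglyMeasurable ?_)
      exact (((hφ.continuous_fderiv (by simp)).clm_apply continuous_const).comp
        (continuous_id.sub continuous_const)).neg
    · refine Filter.Eventually.of_forall fun z s _ => ?_
      rw [norm_mul, norm_neg]
      exact mul_le_mul_of_nonneg_left (hM _) (norm_nonneg _)
    · exact hu1.norm.mul_const M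
    · refine Filter.Eventually.of_forall fun z s _ => ?_
      have h1 : HasDerivAt (fun s : ℝ => z - s • h) (-h) s := by
        simpa using ((hasDerivAt_id s).smul_const h).const_sub z
      have h2 : HasFDerivAt φ (fderiv ℝ φ (z - s • h)) (z - s • h) :=
        ((hφ.differentiable (by simp)) _).hasFDerivAt
      have h3 := (h2.comp_hasDerivAt s h1).const_mul (u z)
      simpa using h3
  have hval : ∀ s ∈ Icc (0 : ℝ) 1, (∫ z in U, u z * -(fderiv ℝ φ (z - s • h) h))
      = ∫ z in U, (∑ i, h i * v i z) * φ (z - s • h) := by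
    intro s hs
    have hint : ∀ i, Integrable (fun z => u z * partialDeriv i φ (z - s • h))
        (volume.restrict U) := by
      intro i
      have hc := hasCompactSupport_partialDeriv (hcc s) i
      have := ((continuous_partialDeriv (hcs s) i).memLp_of_hasCompactSupport
        (p := 2) (μ := volume) hc).restrict U
      have := hu.integrable_mul this
      simp only [partialDeriv_comp_sub, Pi.mul_def] at this
      exact this
    have h1 : ∀ i, ∫ z in U, u z * partialDeriv i φ (z - s • h)
        = - ∫ z in U, v i z * φ (z - s • h) := by
      intro i
      have := hw i _ (hcs s) (hcc s) (hts s hs)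
      simpa only [partialDeriv_comp_sub] using this
    have h2 : ∀ z, u z * -(fderiv ℝ φ (z - s • h) h)
        = ∑ i, -h i * (u z * partialDeriv i φ (z - s • h)) := by
      intro z
      rw [fderiv_eq_sum_partialDeriv]
      simp only [Fin.sum_univ_two]; ring
    have h3 : ∀ z, (∑ i, h i * v i z) * φ (z - s • h)
        = ∑ i, h i * (v i z * φ (z - s • h)) := by
      intro z
      simp only [Fin.sum_univ_two]; ring
    simp only [h2, h3]
    have hint' : ∀ i, Integrable (fun z => v i z * φ (z - s • h)) (volume.restrict U) :=
      fun i => (hv i).integrable_mul (hφL s)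
    rw [integral_finsetSum _ fun i _ => (hint i).const_mul _,
      integral_finsetSum _ fun i _ => (hint' i).const_mul _]
    refine Finset.sum_congr rfl fun i _ => ?_
    rw [integral_const_mul, integral_const_mul, h1]
    ring
  have key := norm_image_sub_le_of_norm_deriv_le_segment_01'
    (f := fun s : ℝ => ∫ z in U, u z * φ (z - s • h))
    (C := √(∫ z in U, (∑ i, h i * v i z) ^ 2) * √(∫ z, φ z ^ 2))
    (fun s _ => (hder s).hasDerivWithinAt) (fun s hs => by
      rw [hval s ⟨hs.1, hs.2.le⟩, Real.norm_eq_abs]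
      refine (abs_integral_mul_le hVL (hφL s)).trans ?_
      gcongr
      exact hφs s)
  simpa using key

/-- Test functions are dense in `L²` of an open set, in dual form. -/
lemma integral_sq_le_of_forall_test {W : Set Plane} (hW : IsOpen W) {d : Plane → ℝ}
    (hd : MemLp d 2 (volume.restrict W)) {K : ℝ}
    (hK : ∀ φ : Plane → ℝ, ContDiff ℝ ∞ φ → HasCompactSupport φ → tsupport φ ⊆ W →
      |∫ z in W, d z * φ z| ≤ K * √(∫ z, φ z ^ 2)) :
    ∫ z in W, d z ^ 2 ≤ K ^ 2 := by
  let S : Submodule ℝ (Lp ℝ 2 (volume.restrict W)) :=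
    { carrier := {f | ∃ φ : Plane → ℝ, ContDiff ℝ ∞ φ ∧ HasCompactSupport φ ∧ tsupport φ ⊆ W ∧
        f =ᵐ[volume.restrict W] φ}
      add_mem' := by
        rintro f g ⟨φ, h1, h2, h3, h4⟩ ⟨ψ, k1, k2, k3, k4⟩
        refine ⟨φ + ψ, h1.add k1, h2.add k2,
          (tsupport_add φ ψ).trans (union_subset h3 k3), ?_⟩
        exact (Lp.coeFn_add f g).trans (h4.add k4)
      zero_mem' := by
        refine ⟨0, contDiff_const, HasCompactSupport.zero, ?_, Lp.coeFn_zero _ _ _⟩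
        simp [tsupport]
      smul_mem' := by
        rintro c f ⟨φ, h1, h2, h3, h4⟩
        refine ⟨fun z => c * φ z, contDiff_const.mul h1, h2.mul_left,
          (tsupport_mul_subset_right).trans h3, ?_⟩
        filter_upwards [Lp.coeFn_smul c f, h4] with z hz hz'
        simp [hz, hz'] }
  -- A function orthogonal to all test functions vanishes, by the fundamental lemma of the calculus
  -- of variations.
  have hdense : S.topologicalClosure = ⊤ := by
    rw [Submodule.topologicalClosure_eq_top_iff, Submodule.eq_bot_iff]
    intro f hf
    rw [Submodule.mem_orthogonal] at hf
    have hfl : MemLp f 2 (volume.restrict W) := Lp.memLp f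
    have h0 : ∀ᵐ x ∂volume, x ∈ W → f x = 0 := by
      refine hW.ae_eq_zero_of_integral_contDiff_smul_eq_zero ?_ ?_
      · rw [locallyIntegrableOn_iff hW.isLocallyClosed]
        intro k hkW hk
        have : IsFiniteMeasure (volume.restrict k) := ⟨by simpa using hk.measure_lt_top⟩
        have := hfl.mono_measure (Measure.restrict_mono hkW le_rfl)
        exact this.integrable (by norm_num)
      · intro φ h1 h2 h3
        have hφL : MemLp φ 2 (volume.restrict W) :=
          (h1.continuous.memLp_of_hasCompactSupport h2).restrict W
        have := hf (hφL.toLp φ) ⟨φ, h1, h2, h3, hφL.coeFn_toLp⟩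
        rw [← Lp.toLp_coeFn f hfl, inner_toLp] at this
        rw [← this, ← integral_indicator hW.measurableSet]
        refine integral_congr_ae (Filter.Eventually.of_forall fun x => ?_)
        by_cases hx : x ∈ W
        · simp [hx]
        · have : φ x = 0 := image_eq_zero_of_notMem_tsupport fun h => hx (h3 h)
          simp [hx, this]
    rw [Lp.eq_zero_iff_ae_eq_zero]
    exact (ae_restrict_iff' hW.measurableSet).2 h0
  -- The bound passes to the closure of the test functions; at `f = d` it reads `‖d‖² ≤ K ‖d‖`.
  have hall : ∀ f : Lp ℝ 2 (volume.restrict W), |inner ℝ (hd.toLp d) f| ≤ K * ‖f‖ := by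
    intro f
    have hf : f ∈ closure (S : Set (Lp ℝ 2 (volume.restrict W))) := by
      rw [← Submodule.topologicalClosure_coe, hdense]; trivial
    have hcl : IsClosed {f : Lp ℝ 2 (volume.restrict W) | |inner ℝ (hd.toLp d) f| ≤ K * ‖f‖} :=
      isClosed_le (by fun_prop) (by fun_prop)
    refine closure_minimal ?_ hcl hf
    rintro g ⟨φ, h1, h2, h3, h4⟩
    have hφL : MemLp φ 2 (volume.restrict W) :=
      (h1.continuous.memLp_of_hasCompactSupport h2).restrict W
    have hg : g = hφL.toLp φ := by
      apply Lp.ext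
      exact h4.trans hφL.coeFn_toLp.symm
    have hfull : ∫ z in W, φ z ^ 2 = ∫ z, φ z ^ 2 := by
      rw [← integral_indicator hW.measurableSet]
      refine integral_congr_ae (Filter.Eventually.of_forall fun x => ?_)
      by_cases hx : x ∈ W
      · simp [hx]
      · have : φ x = 0 := image_eq_zero_of_notMem_tsupport fun h => hx (h3 h)
        simp [hx, this]
    rw [mem_ofPred_eq, hg, inner_toLp, norm_toLp_eq_sqrt, hfull]
    exact hK φ h1 h2 h3
  have h1 := hall (hd.toLp d)
  rw [real_inner_self_eq_norm_sq, abs_of_nonneg (sq_nonneg _)] at h1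
  rw [← norm_toLp_sq hd]
  nlinarith [norm_nonneg (hd.toLp d)]

lemma integral_translate_sub_sq_le {U W : Set Plane} (hU : IsOpen U) (hfin : volume U ≠ ⊤)
    (hW : IsOpen W)
    {u : Plane → ℝ} {v : Fin 2 → Plane → ℝ} (hu : MemLp u 2 (volume.restrict U))
    (hv : ∀ i, MemLp (v i) 2 (volume.restrict U)) (hw : ∀ i, HasWeakPartial U i u (v i))
    (h : Plane) (hWU : ∀ x ∈ W, ∀ s ∈ Icc (0 : ℝ) 1, x + s • h ∈ U) :
    ∫ z in W, (u (z + h) - u z) ^ 2 ≤ ∫ z in U, (∑ i, h i * v i z) ^ 2 := by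
  have hWsub : W ⊆ U := fun x hx => by simpa using hWU x hx 0 (by simp)
  have hWsub' : W ⊆ (fun x => x + h) ⁻¹' U := fun x hx => by simpa using hWU x hx 1 (by simp)
  have hmp : MeasurePreserving (fun x : Plane => x + h)
      (volume.restrict ((fun x => x + h) ⁻¹' U)) (volume.restrict U) :=
    (measurePreserving_add_right volume h).restrict_preimage hU.measurableSet
  have hut : MemLp (fun z => u (z + h)) 2 (volume.restrict W) :=
    (hu.comp_measurePreserving hmp).mono_measure (Measure.restrict_mono hWsub' le_rfl)
  have hu' : MemLp u 2 (volume.restrict W) := hu.mono_measure (Measure.restrict_mono hWsub le_rfl)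
  have := integral_sq_le_of_forall_test hW (hut.sub hu')
    (K := √(∫ z in U, (∑ i, h i * v i z) ^ 2)) ?_
  · rwa [Real.sq_sqrt (integral_nonneg fun z => sq_nonneg _)] at this
  intro φ h1 h2 h3
  refine le_trans (le_of_eq ?_) (abs_integral_translate_sub_le hfin hu hv hw h hWU h1 h2 h3)
  have hφL : MemLp φ 2 (volume.restrict W) :=
    (h1.continuous.memLp_of_hasCompactSupport h2).restrict W
  have e0 : ∀ x ∉ W, φ x = 0 := fun x hx =>
    image_eq_zero_of_notMem_tsupport fun h => hx (h3 h)
  have e1 : ∫ z in U, u z * φ z = ∫ z in W, u z * φ z := by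
    refine setIntegral_eq_of_subset_of_forall_sdiff_eq_zero hU.measurableSet hWsub ?_
    intro x hx
    rw [e0 x hx.2, mul_zero]
  have e2 : ∫ z in U, u z * φ (z - h) = ∫ z in W, u (z + h) * φ z := by
    rw [← hmp.integral_comp (MeasurableEquiv.addRight h).measurableEmbedding]
    simp only [add_sub_cancel_right]
    refine setIntegral_eq_of_subset_of_forall_sdiff_eq_zero
      (hU.preimage (by fun_prop)).measurableSet hWsub' ?_
    intro x hx
    rw [e0 x hx.2, mul_zero]
  have i1 : Integrable (fun z => u (z + h) * φ z) (volume.restrict W) := hut.integrable_mul hφL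
  have i2 : Integrable (fun z => u z * φ z) (volume.restrict W) := hu'.integrable_mul hφL
  rw [e1, e2, ← integral_sub i1 i2]
  simp only [Pi.sub_apply, sub_mul]

/-! ### Geometry of sectors and of polygonal domains -/

/-- The unit vector of angle `φ`. -/
noncomputable def dir (φ : ℝ) : Plane := !₂[Real.cos φ, Real.sin φ]

lemma inner_plane (a b : Plane) : inner ℝ a b = a 0 * b 0 + a 1 * b 1 := by
  simp [PiLp.inner_apply, Fin.sum_univ_two, mul_comm]

lemma norm_sq_plane (a : Plane) : ‖a‖ ^ 2 = a 0 ^ 2 + a 1 ^ 2 := by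
  simp [EuclideanSpace.norm_sq_eq, Fin.sum_univ_two]

lemma inner_dir_dir (a b : ℝ) : inner ℝ (dir a) (dir b) = Real.cos (a - b) := by
  rw [inner_plane, Real.cos_sub]; simp [dir]

lemma norm_dir (a : ℝ) : ‖dir a‖ = 1 := by
  have h : ‖dir a‖ ^ 2 = 1 := by
    rw [norm_sq_plane]; simp [dir]
  nlinarith [norm_nonneg (dir a)]

/-- Polar coordinates with angles measured from `ψ`: as a complex number, `v` is rotated by `-ψ`,
and `a` is the principal argument of the result. -/
lemma exists_eq_norm_smul_dir (v : Plane) (ψ : ℝ) :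
    ∃ a : ℝ, |a| ≤ Real.pi ∧ v = ‖v‖ • dir (ψ + a) := by
  set c : ℂ := ⟨v 0, v 1⟩ with hc
  set w : ℂ := c * Complex.exp (-(ψ * Complex.I)) with hw
  have hcw : c = ‖w‖ * Complex.exp (((ψ + w.arg : ℝ) : ℂ) * Complex.I) := by
    have h1 := Complex.norm_mul_exp_arg_mul_I w
    have h2 : c = w * Complex.exp (ψ * Complex.I) := by
      rw [hw, mul_assoc, ← Complex.exp_add]; simp
    rw [h2]
    conv_lhs => rw [← h1]
    rw [mul_assoc, ← Complex.exp_add]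
    congr 2
    push_cast; ring
  have hn : ‖w‖ = ‖v‖ := by
    have h1 : ‖w‖ = ‖c‖ := by
      rw [hw, norm_mul, ← neg_mul, ← Complex.ofReal_neg, Complex.norm_exp_ofReal_mul_I, mul_one]
    have h2 : ‖c‖ ^ 2 = ‖v‖ ^ 2 := by
      rw [norm_sq_plane, Complex.sq_norm, Complex.normSq_apply]; ring
    rw [h1]
    exact (sq_eq_sq₀ (norm_nonneg _) (norm_nonneg _)).1 h2
  refine ⟨w.arg, Complex.abs_arg_le_pi w, ?_⟩
  rw [hn] at hcw
  ext i
  fin_cases i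
  · have := congrArg Complex.re hcw
    rw [Complex.re_ofReal_mul, Complex.exp_ofReal_mul_I_re] at this
    simpa [dir] using this
  · have := congrArg Complex.im hcw
    rw [Complex.im_ofReal_mul, Complex.exp_ofReal_mul_I_im] at this
    simpa [dir] using this

/-- The angle to the bisector is below `η / 2`, and cosine decreases on `[0, π]`. The resulting cone
condition is free of angles and covers convex and reentrant corners alike. -/
lemma mem_sector_iff {z ζ : Plane} {r θ η : ℝ} (hη : 0 < η) (hη' : η < 2 * Real.pi) :
    ζ ∈ sector z r θ η ↔ 0 < ‖ζ - z‖ ∧ ‖ζ - z‖ < r ∧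
      ‖ζ - z‖ * Real.cos (η / 2) < inner ℝ (ζ - z) (dir (θ + η / 2)) := by
  constructor
  · rintro ⟨ρ, ⟨hρ, hρr⟩, φ, ⟨h1, h2⟩, rfl⟩
    change _ < ‖z + ρ • dir φ - z‖ ∧ ‖z + ρ • dir φ - z‖ < _ ∧ ‖z + ρ • dir φ - z‖ * _ <
      inner ℝ (z + ρ • dir φ - z) _
    rw [add_sub_cancel_left, norm_smul, norm_dir, real_inner_smul_left, inner_dir_dir, mul_one,
      Real.norm_of_nonneg hρ.le]
    refine ⟨hρ, hρr, mul_lt_mul_of_pos_left ?_ hρ⟩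
    rw [← Real.cos_abs (φ - _)]
    apply Real.cos_lt_cos_of_nonneg_of_le_pi (abs_nonneg _) (by linarith)
    rw [abs_lt]; constructor <;> linarith
  · rintro ⟨h0, h1, h2⟩
    obtain ⟨a, ha, hv⟩ := exists_eq_norm_smul_dir (ζ - z) (θ + η / 2)
    refine ⟨‖ζ - z‖, ⟨h0, h1⟩, θ + η / 2 + a, ?_, ?_⟩
    · rw [hv, real_inner_smul_left, inner_dir_dir, ← hv, add_sub_cancel_left] at h2
      have h3 := lt_of_mul_lt_mul_left h2 h0.le
      have h4 : |a| < η / 2 := by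
        by_contra! h
        rw [← Real.cos_abs a] at h3
        exact absurd (Real.cos_le_cos_of_nonneg_of_le_pi (by linarith) ha h) (not_le.2 h3)
      rw [abs_lt] at h4
      constructor <;> linarith
    · change ζ = z + ‖ζ - z‖ • dir (θ + η / 2 + a)
      rw [← hv]; abel

lemma neg_one_lt_cos_half {η : ℝ} (hη : 0 < η) (hη' : η < 2 * Real.pi) :
    -1 < Real.cos (η / 2) := by
  rw [← Real.cos_pi]
  exact Real.cos_lt_cos_of_nonneg_of_le_pi (by linarith) le_rfl (by linarith)

lemma cos_half_lt_one {η : ℝ} (hη : 0 < η) (hη' : η < 2 * Real.pi) :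
    Real.cos (η / 2) < 1 := by
  rw [← Real.cos_zero]
  exact Real.cos_lt_cos_of_nonneg_of_le_pi le_rfl (by linarith) (by linarith)

/-- Near a boundary point of a polygonal domain there is a direction in which one can move
without leaving the domain. -/
lemma IsPolygonalDomain.exists_translation {Ω : Set Plane} (hΩ : IsPolygonalDomain Ω)
    {z : Plane} (hz : z ∈ frontier Ω) : ∃ h : Plane, z + h ∈ Ω ∧ ∃ ε > 0,
      ∀ x ∈ Ω ∩ Metric.ball z ε, ∀ s ∈ Icc (0 : ℝ) 1, x + s • h ∈ Ω := by
  obtain ⟨r, θ, η, hr, hη, hη', hS⟩ := hΩ.locally_sector z hz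
  have hsub : sector z r θ η ⊆ Ω := hS ▸ inter_subset_left
  set e := dir (θ + η / 2) with he
  have hee : inner ℝ e e = (1 : ℝ) := by rw [he, inner_dir_dir]; simp
  have hen : ‖e‖ = 1 := norm_dir _
  have hc1 := neg_one_lt_cos_half hη hη'
  have hc2 := cos_half_lt_one hη hη'
  refine ⟨(r / 4) • e, hsub ((mem_sector_iff hη hη').2 ?_), r / 4, by positivity, ?_⟩
  · rw [add_sub_cancel_left, norm_smul, hen, real_inner_smul_left, hee,
      Real.norm_of_nonneg (by positivity)]
    refine ⟨by positivity, by linarith, ?_⟩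
    nlinarith
  rintro x ⟨hx, hxb⟩ s ⟨hs0, hs1⟩
  have hxn : ‖x - z‖ < r / 4 := by rwa [← dist_eq_norm]
  have hxS : x ∈ sector z r θ η := by
    rw [← hS]; exact ⟨hx, by rw [Metric.mem_ball, dist_eq_norm]; linarith⟩
  obtain ⟨k0, k1, k2⟩ := (mem_sector_iff hη hη').1 hxS
  apply hsub
  rw [mem_sector_iff hη hη']
  set t := s * (r / 4) with ht
  have ht0 : 0 ≤ t := by positivity
  have ht1 : t ≤ r / 4 := by rw [ht]; nlinarith
  have heq : x + s • (r / 4) • e - z = (x - z) + t • e := by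
    rw [smul_smul]; abel
  rw [heq, inner_add_left, real_inner_smul_left, hee, mul_one]
  have n1 : ‖(x - z) + t • e‖ ≤ ‖x - z‖ + t := by
    refine (norm_add_le _ _).trans ?_
    rw [norm_smul, hen, mul_one, Real.norm_of_nonneg ht0]
  have n2 : ‖x - z‖ ≤ ‖(x - z) + t • e‖ + t := by
    have := norm_sub_le ((x - z) + t • e) (t • e)
    rwa [add_sub_cancel_right, norm_smul, hen, mul_one, Real.norm_of_nonneg ht0] at this
  -- At a convex corner (`cos ≥ 0`) the upper bound `n1` on the new norm is used, at a reentrant one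
  -- the lower bound `n2`. The room comes from `-1 < cos (η / 2) < 1`.
  have key : ‖(x - z) + t • e‖ * Real.cos (η / 2) < inner ℝ (x - z) e + t := by
    rcases le_total 0 (Real.cos (η / 2)) with h | h <;> nlinarith
  refine ⟨?_, by linarith, key⟩
  rw [norm_pos_iff]
  intro h0
  rw [h0, norm_zero, zero_mul] at key
  have : inner ℝ (x - z + t • e) e = (0 : ℝ) := by rw [h0, inner_zero_left]
  rw [inner_add_left, real_inner_smul_left, hee, mul_one] at this
  linarith

/-- Polygonal domains have no slits: leaving a boundary point against the bisector, one reaches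
points outside the closure, since `cos (η / 2) > -1`. This places the open elements of a
triangulation inside `Ω`. -/
lemma IsPolygonalDomain.interior_closure {Ω : Set Plane} (hΩ : IsPolygonalDomain Ω) :
    interior (closure Ω) = Ω := by
  refine subset_antisymm (fun z hz => ?_) (interior_maximal subset_closure hΩ.isOpen)
  by_contra hzΩ
  have hzf : z ∈ frontier Ω := by
    rw [hΩ.isOpen.frontier_eq]; exact ⟨interior_subset hz, hzΩ⟩
  obtain ⟨r, θ, η, hr, hη, hη', hS⟩ := hΩ.locally_sector z hzf
  set e := dir (θ + η / 2) with he
  have hee : inner ℝ e e = (1 : ℝ) := by rw [he, inner_dir_dir]; simp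
  have hen : ‖e‖ = 1 := norm_dir _
  have hc1 := neg_one_lt_cos_half hη hη'
  obtain ⟨ε, hε, hball⟩ := Metric.isOpen_iff.1 isOpen_interior z hz
  set t := min r ε / 2 with ht
  have hmin : 0 < min r ε := lt_min hr hε
  have ht0 : 0 < t := by positivity
  have htr : t < r := by have := min_le_left r ε; linarith
  have htε : t < ε := by have := min_le_right r ε; linarith
  set y := z - t • e with hy
  have hyz : y - z = -(t • e) := by rw [hy]; abel
  have hyn : ‖y - z‖ = t := by
    rw [hyz, norm_neg, norm_smul, hen, mul_one, Real.norm_of_nonneg ht0.le]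
  have hyc : y ∈ closure Ω := interior_subset (hball (by rw [Metric.mem_ball, dist_eq_norm, hyn]; exact htε))
  have hopen : IsOpen ({ζ : Plane | ‖ζ - z‖ < r} ∩
      {ζ : Plane | inner ℝ (ζ - z) e < ‖ζ - z‖ * Real.cos (η / 2)}) :=
    (isOpen_lt (by fun_prop) (by fun_prop)).inter (isOpen_lt (by fun_prop) (by fun_prop))
  obtain ⟨x, ⟨hx1, hx2⟩, hxΩ⟩ := mem_closure_iff.1 hyc _ hopen (by
    refine ⟨by rw [mem_ofPred_eq, hyn]; exact htr, ?_⟩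
    rw [mem_ofPred_eq, hyn, hyz, inner_neg_left, real_inner_smul_left, hee]
    nlinarith)
  have : x ∈ sector z r θ η := by
    rw [← hS]; exact ⟨hxΩ, by rwa [Metric.mem_ball, dist_eq_norm]⟩
  exact absurd ((mem_sector_iff hη hη').1 this).2.2 (not_lt.2 hx2.le)

/-! ### Outward normals -/

/-- By scaling, the two local half-planes agree globally. If `n ≠ m` then `⟨n, m⟩ < 1`, and the
vector `m - n` lies in one half-plane but not in the other. -/
lemma IsOutwardNormal.eq {U : Set Plane} {z n m : Plane} (hn : IsOutwardNormal U z n)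
    (hm : IsOutwardNormal U z m) : n = m := by
  obtain ⟨-, hn1, r, hr, hU⟩ := hn
  obtain ⟨-, hm1, r', hr', hU'⟩ := hm
  have hiff : ∀ v : Plane, inner ℝ v n < (0 : ℝ) ↔ inner ℝ v m < (0 : ℝ) := by
    intro v
    set t := min r r' / (2 * (‖v‖ + 1)) with ht
    have hmin : 0 < min r r' := lt_min hr hr'
    have ht0 : 0 < t := by positivity
    have hlt : ‖t • v‖ < min r r' := by
      rw [norm_smul, Real.norm_of_nonneg ht0.le, ht, div_mul_eq_mul_div, div_lt_iff₀ (by positivity)]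
      nlinarith [norm_nonneg v]
    have h1 := hU (z + t • v) (by
      rw [Metric.mem_ball, dist_eq_norm, add_sub_cancel_left]; exact hlt.trans_le (min_le_left _ _))
    have h2 := hU' (z + t • v) (by
      rw [Metric.mem_ball, dist_eq_norm, add_sub_cancel_left]; exact hlt.trans_le (min_le_right _ _))
    rw [add_sub_cancel_left, real_inner_smul_left] at h1 h2
    have hm : ∀ a : ℝ, t * a < 0 ↔ a < 0 := fun a =>
      ⟨fun h => by by_contra! ha; exact absurd h (not_lt.2 (by positivity)),
        fun h => mul_neg_of_pos_of_neg ht0 h⟩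
    rw [← hm, ← h1, h2, hm]
  have hnn : inner ℝ n n = (1 : ℝ) := by rw [real_inner_self_eq_norm_sq, hn1]; norm_num
  have hmm : inner ℝ m m = (1 : ℝ) := by rw [real_inner_self_eq_norm_sq, hm1]; norm_num
  by_contra hne
  have hlt : inner ℝ n m < (1 : ℝ) := by
    have h := sub_ne_zero.2 hne
    have h1 : 0 < inner ℝ (n - m) (n - m) := real_inner_self_pos.2 h
    rw [inner_sub_left, inner_sub_right, inner_sub_right, hnn, hmm, real_inner_comm n m] at h1
    linarith
  have h1 := (hiff (m - n)).1 (by rw [inner_sub_left, hnn, real_inner_comm]; linarith)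
  rw [inner_sub_left, hmm] at h1
  linarith

lemma IsOutwardNormal.outwardNormal_eq {U : Set Plane} {z n : Plane}
    (hn : IsOutwardNormal U z n) : outwardNormal U z = n := by
  have h : ∃ n, IsOutwardNormal U z n := ⟨n, hn⟩
  rw [outwardNormal, dif_pos h]
  exact h.choose_spec.eq hn

lemma norm_outwardNormal_le (U : Set Plane) (z : Plane) : ‖outwardNormal U z‖ ≤ 1 := by
  rw [outwardNormal]
  split_ifs with h
  · exact h.choose_spec.2.1.le
  · simp

/-- A set which is locally a half-plane at `z` has an outward normal there. -/
lemma isOutwardNormal_of_ball {U : Set Plane} {z n : Plane} (hn : ‖n‖ = 1) {r : ℝ} (hr : 0 < r)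
    (h : ∀ ζ ∈ Metric.ball z r, ζ ∈ U ↔ inner ℝ (ζ - z) n < 0) : IsOutwardNormal U z n := by
  refine ⟨⟨?_, ?_⟩, hn, r, hr, h⟩
  · rw [Metric.mem_closure_iff]
    intro ε hε
    have hmin : 0 < min r ε := lt_min hr hε
    have hd : dist (z - (min r ε / 2) • n) z = min r ε / 2 := by
      rw [dist_eq_norm, sub_sub_cancel_left, norm_neg, norm_smul, hn, mul_one,
        Real.norm_of_nonneg (by positivity)]
    refine ⟨z - (min r ε / 2) • n, (h _ ?_).2 ?_, ?_⟩
    · rw [Metric.mem_ball, hd]; have := min_le_left r ε; linarith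
    · rw [sub_sub_cancel_left, inner_neg_left, real_inner_smul_left, real_inner_self_eq_norm_sq, hn]
      nlinarith
    · rw [dist_comm, hd]; have := min_le_right r ε; linarith
  · intro hz
    have := (h z (Metric.mem_ball_self hr)).1 (interior_subset hz)
    simp at this

lemma inner_eq_zero_of_mem_frontier {U : Set Plane} {z n : Plane} {r : ℝ}
    (h : ∀ ζ ∈ Metric.ball z r, ζ ∈ U ↔ inner ℝ (ζ - z) n < 0) {ζ : Plane}
    (hζ : ζ ∈ Metric.ball z r) (hf : ζ ∈ frontier U) : inner ℝ (ζ - z) n = 0 := by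
  rcases lt_trichotomy (inner ℝ (ζ - z) n) 0 with hlt | heq | hgt
  · exfalso
    refine hf.2 (mem_interior.2 ⟨Metric.ball z r ∩ {y | inner ℝ (y - z) n < 0}, ?_, ?_, hζ, hlt⟩)
    · rintro y ⟨hy, hy'⟩; exact (h y hy).2 hy'
    · exact Metric.isOpen_ball.inter (isOpen_lt (by fun_prop) (by fun_prop))
  · exact heq
  · exfalso
    have hopen : IsOpen (Metric.ball z r ∩ {y | 0 < inner ℝ (y - z) n}) :=
      Metric.isOpen_ball.inter (isOpen_lt (by fun_prop) (by fun_prop))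
    obtain ⟨y, ⟨hy, hy'⟩, hyU⟩ := mem_closure_iff.1 hf.1 _ hopen ⟨hζ, hgt⟩
    exact absurd ((h y hy).1 hyU) (not_lt.2 (le_of_lt hy'))

/-! ### The Friedrichs inequality -/

/-- The propagation step: `u(z)² ≤ 2 u(z + h)² + 2 (u(z + h) - u(z))²`, so control of `u` on the
translate of `W` passes to `W` at the cost of the gradient. -/
lemma integral_sq_le_translate {U W : Set Plane} (hU : IsOpen U) (hfin : volume U ≠ ⊤)
    (hW : IsOpen W)
    {u : Plane → ℝ} {v : Fin 2 → Plane → ℝ} (hu : MemLp u 2 (volume.restrict U))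
    (hv : ∀ i, MemLp (v i) 2 (volume.restrict U)) (hw : ∀ i, HasWeakPartial U i u (v i))
    (h : Plane) (hWU : ∀ x ∈ W, ∀ s ∈ Icc (0 : ℝ) 1, x + s • h ∈ U) :
    ∫ z in W, u z ^ 2 ≤ 2 * (∫ z in W, u (z + h) ^ 2)
      + 2 * ‖h‖ ^ 2 * ∫ z in U, ∑ i, v i z ^ 2 := by
  have hWsub : W ⊆ U := fun x hx => by simpa using hWU x hx 0 (by simp)
  have hWsub' : W ⊆ (fun x => x + h) ⁻¹' U := fun x hx => by simpa using hWU x hx 1 (by simp)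
  have hmp : MeasurePreserving (fun x : Plane => x + h)
      (volume.restrict ((fun x => x + h) ⁻¹' U)) (volume.restrict U) :=
    (measurePreserving_add_right volume h).restrict_preimage hU.measurableSet
  have hut : MemLp (fun z => u (z + h)) 2 (volume.restrict W) :=
    (hu.comp_measurePreserving hmp).mono_measure (Measure.restrict_mono hWsub' le_rfl)
  have hu' : MemLp u 2 (volume.restrict W) := hu.mono_measure (Measure.restrict_mono hWsub le_rfl)
  have hd : MemLp (fun z => u (z + h) - u z) 2 (volume.restrict W) := hut.sub hu'
  have h1 := integral_translate_sub_sq_le hU hfin hW hu hv hw h hWU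
  have h2 : ∫ z in U, (∑ i, h i * v i z) ^ 2 ≤ ‖h‖ ^ 2 * ∫ z in U, ∑ i, v i z ^ 2 := by
    rw [← integral_const_mul]
    refine integral_mono (memLp_finsetSum _ fun i _ => (hv i).const_mul (h i)).integrable_sq
      ((integrable_finsetSum _ fun i _ => (hv i).integrable_sq).const_mul _) fun z => ?_
    simp only [Fin.sum_univ_two, norm_sq_plane]
    nlinarith [sq_nonneg (h 0 * v 1 z - h 1 * v 0 z)]
  have h3 : ∫ z in W, u z ^ 2 ≤
      ∫ z in W, (2 * u (z + h) ^ 2 + 2 * (u (z + h) - u z) ^ 2) := by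
    refine integral_mono hu'.integrable_sq
      ((hut.integrable_sq.const_mul 2).add (hd.integrable_sq.const_mul 2)) fun z => ?_
    change u z ^ 2 ≤ 2 * u (z + h) ^ 2 + 2 * (u (z + h) - u z) ^ 2
    nlinarith [sq_nonneg (2 * u (z + h) - u z)]
  rw [integral_add (hut.integrable_sq.const_mul 2) (hd.integrable_sq.const_mul 2),
    integral_const_mul, integral_const_mul] at h3
  linarith

/-- `u` is in `H¹(Ω)` with weak gradient `v` and vanishes on the inflow boundary. -/
structure IsAdmissible (Ω : Set Plane) (u : Plane → ℝ) (v : Fin 2 → Plane → ℝ) : Prop where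
  memLp : MemLp u 2 (volume.restrict Ω)
  memLp_grad : ∀ i, MemLp (v i) 2 (volume.restrict Ω)
  hasWeakPartial : ∀ i, HasWeakPartial Ω i u (v i)
  trace : ∃ g, IsTrace Ω u v g ∧ ∀ᵐ z ∂(bdry Ω), z ∈ inflow Ω → g z = 0

/-- The Friedrichs inequality holds on the part of `Ω` in `W`. -/
def HasFriedrichsBound (Ω W : Set Plane) : Prop :=
  ∃ C, 0 ≤ C ∧ ∀ u v, IsAdmissible Ω u v →
    ∫ z in Ω ∩ W, u z ^ 2 ≤ C * ∫ z in Ω, ∑ i, v i z ^ 2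

lemma HasFriedrichsBound.mono {Ω W W' : Set Plane} (h : HasFriedrichsBound Ω W') (hW : W ⊆ W') :
    HasFriedrichsBound Ω W := by
  obtain ⟨C, hC, hb⟩ := h
  refine ⟨C, hC, fun u v huv => le_trans ?_ (hb u v huv)⟩
  refine setIntegral_mono_set ?_ (Filter.Eventually.of_forall fun z => sq_nonneg _)
    (inter_subset_inter_right Ω hW).eventuallyLE
  exact (huv.memLp.mono_measure (Measure.restrict_mono inter_subset_left le_rfl)).integrable_sq

lemma HasFriedrichsBound.union {Ω W W' : Set Plane} (h : HasFriedrichsBound Ω W)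
    (h' : HasFriedrichsBound Ω W') : HasFriedrichsBound Ω (W ∪ W') := by
  obtain ⟨C, hC, hb⟩ := h
  obtain ⟨C', hC', hb'⟩ := h'
  refine ⟨C + C', add_nonneg hC hC', fun u v huv => ?_⟩
  have h1 : ∀ S, Integrable (fun z => u z ^ 2) (volume.restrict (Ω ∩ S)) := fun S =>
    (huv.memLp.mono_measure (Measure.restrict_mono inter_subset_left le_rfl)).integrable_sq
  rw [inter_union_distrib_left, add_mul]
  refine le_trans ?_ (add_le_add (hb u v huv) (hb' u v huv))
  rw [← integral_add_measure (h1 _) (h1 _)]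
  refine integral_mono_measure (Measure.restrict_union_le _ _)
    (Filter.Eventually.of_forall fun z => sq_nonneg _) ((h1 _).add_measure (h1 _))

lemma HasFriedrichsBound.translate {Ω W W' : Set Plane} (hΩ : IsOpen Ω) (hfin : volume Ω ≠ ⊤)
    (hW : IsOpen W) (hW' : IsOpen W') (hb : HasFriedrichsBound Ω W') (h : Plane)
    (hWΩ : ∀ x ∈ Ω ∩ W, ∀ s ∈ Icc (0 : ℝ) 1, x + s • h ∈ Ω)
    (hWW' : ∀ x ∈ Ω ∩ W, x + h ∈ W') : HasFriedrichsBound Ω W := by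
  obtain ⟨C, hC, hb⟩ := hb
  refine ⟨2 * C + 2 * ‖h‖ ^ 2, by positivity, fun u v huv => ?_⟩
  have h1 := integral_sq_le_translate hΩ hfin (hΩ.inter hW) huv.memLp huv.memLp_grad
    huv.hasWeakPartial h hWΩ
  have hmp : MeasurePreserving (fun x : Plane => x + h)
      (volume.restrict ((fun x => x + h) ⁻¹' (Ω ∩ W'))) (volume.restrict (Ω ∩ W')) :=
    (measurePreserving_add_right volume h).restrict_preimage (hΩ.inter hW').measurableSet
  have hsub : Ω ∩ W ⊆ (fun x => x + h) ⁻¹' (Ω ∩ W') := fun x hx =>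
    ⟨by simpa using hWΩ x hx 1 (by simp), hWW' x hx⟩
  have hint : MemLp u 2 (volume.restrict (Ω ∩ W')) :=
    huv.memLp.mono_measure (Measure.restrict_mono inter_subset_left le_rfl)
  have h2 : ∫ z in Ω ∩ W, u (z + h) ^ 2 ≤ ∫ z in Ω ∩ W', u z ^ 2 := by
    rw [← hmp.integral_comp (MeasurableEquiv.addRight h).measurableEmbedding (fun z => u z ^ 2)]
    exact setIntegral_mono_set (hint.comp_measurePreserving hmp).integrable_sq
      (Filter.Eventually.of_forall fun z => sq_nonneg _) hsub.eventuallyLE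
  have h3 := hb u v huv
  linarith

/-- Extension by zero across the inflow boundary is weakly differentiable. -/
lemma IsAdmissible.hasWeakPartial_indicator {Ω : Set Plane} (hΩ : IsOpen Ω) {u : Plane → ℝ}
    {v : Fin 2 → Plane → ℝ} (huv : IsAdmissible Ω u v) {B : Set Plane} (hB : IsOpen B)
    (hfB : frontier Ω ∩ B ⊆ inflow Ω) (i : Fin 2) :
    HasWeakPartial B i (Ω.indicator u) (Ω.indicator (v i)) := by
  intro φ h1 h2 h3
  obtain ⟨g, ⟨-, hg⟩, hg0⟩ := huv.trace
  have hφL : MemLp φ 2 (volume.restrict Ω) :=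
    (h1.continuous.memLp_of_hasCompactSupport h2).restrict Ω
  have hdL : MemLp (partialDeriv i φ) 2 (volume.restrict Ω) :=
    ((continuous_partialDeriv h1 i).memLp_of_hasCompactSupport
      (hasCompactSupport_partialDeriv h2 i)).restrict Ω
  have e0 : ∀ x ∉ B, φ x = 0 := fun x hx =>
    image_eq_zero_of_notMem_tsupport fun h => hx (h3 h)
  have e1 : ∀ x ∉ B, partialDeriv i φ x = 0 := fun x hx =>
    image_eq_zero_of_notMem_tsupport fun h => hx (h3 (tsupport_partialDeriv_subset φ i h))
  have key : ∀ f ψ : Plane → ℝ, (∀ x ∉ B, ψ x = 0) →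
      ∫ z in B, Ω.indicator f z * ψ z = ∫ z in Ω, f z * ψ z := by
    intro f ψ hψ
    rw [← integral_indicator hB.measurableSet, ← integral_indicator hΩ.measurableSet]
    refine integral_congr_ae (Filter.Eventually.of_forall fun x => ?_)
    by_cases hx : x ∈ B <;> by_cases hx' : x ∈ Ω <;> simp [hx, hx', hψ]
  rw [key _ _ e1, key _ _ e0]
  have h4 := hg φ h1 h2 i
  -- On `B` the boundary is inflow, where `g` vanishes almost everywhere; off `B` the test function
  -- vanishes.
  have h5 : ∫ z, g z * φ z * outwardNormal Ω z i ∂(bdry Ω) = 0 := by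
    refine integral_eq_zero_of_ae ?_
    have hmem : ∀ᵐ z ∂(bdry Ω), z ∈ frontier Ω :=
      ae_restrict_mem isClosed_frontier.measurableSet
    filter_upwards [hg0, hmem] with z hz hzf
    by_cases hzB : z ∈ B
    · simp [hz (hfB ⟨hzf, hzB⟩)]
    · simp [e0 z hzB]
  have i1 : Integrable (fun z => v i z * φ z) (volume.restrict Ω) :=
    (huv.memLp_grad i).integrable_mul hφL
  have i2 : Integrable (fun z => u z * partialDeriv i φ z) (volume.restrict Ω) :=
    huv.memLp.integrable_mul hdL
  rw [h5, integral_add i1 i2] at h4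
  linarith

/-- Near such a point the boundary is a straight line with constant normal `n`, and `x n₂ < 0` is an
open condition. -/
lemma exists_ball_frontier_subset_inflow {Ω : Set Plane} {z : Plane} (hz : z ∈ inflow Ω) :
    ∃ n : Plane, ‖n‖ = 1 ∧ ∃ r > 0, frontier Ω ∩ Metric.ball z r ⊆ inflow Ω ∧
      ∀ ζ ∈ Metric.ball z r, ζ ∈ Ω ↔ inner ℝ (ζ - z) n < 0 := by
  obtain ⟨n, ⟨hzf, hn, r, hr, hU⟩, hn0, hxn⟩ := hz
  have hopen : IsOpen {ζ : Plane | ζ 0 * n 1 < 0} := isOpen_lt (by fun_prop) (by fun_prop)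
  obtain ⟨r', hr', hball⟩ := Metric.isOpen_iff.1 hopen z hxn
  refine ⟨n, hn, min r r', lt_min hr hr', ?_, fun ζ hζ =>
    hU ζ (Metric.ball_subset_ball (min_le_left _ _) hζ)⟩
  rintro ζ ⟨hζf, hζ⟩
  have hζr := Metric.ball_subset_ball (min_le_left r r') hζ
  have h0 := inner_eq_zero_of_mem_frontier hU hζr hζf
  refine ⟨n, ?_, hn0, hball (Metric.ball_subset_ball (min_le_right _ _) hζ)⟩
  obtain ⟨ε, hε, hsub⟩ := Metric.isOpen_iff.1 Metric.isOpen_ball ζ hζr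
  refine ⟨hζf, hn, ε, hε, fun y hy => ?_⟩
  rw [hU y (hsub hy), ← sub_add_sub_cancel y ζ z, inner_add_left, h0, add_zero]

/-- Start of the propagation. The extension by zero is weakly differentiable in the ball of radius
`r`. The shift by `(r / 2) n` takes the ball of radius `r / 4` out of `Ω` but not out of the large
ball, so the shifted function is zero and only the gradient remains. -/
lemma exists_friedrichs_ball_of_mem_inflow {Ω : Set Plane} (hΩ : IsOpen Ω) {z : Plane}
    (hz : z ∈ inflow Ω) : ∃ ε > 0, HasFriedrichsBound Ω (Metric.ball z ε) := by
  obtain ⟨n, hn, r, hr, hfr, hU⟩ := exists_ball_frontier_subset_inflow hz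
  refine ⟨r / 4, by positivity, 2 * ‖(r / 2) • n‖ ^ 2, by positivity, fun u v huv => ?_⟩
  set B := Metric.ball z r with hB
  set W := Metric.ball z (r / 4) with hW
  have hhn : ‖(r / 2) • n‖ = r / 2 := by
    rw [norm_smul, hn, mul_one, Real.norm_of_nonneg (by positivity)]
  have hWB : ∀ x ∈ W, ∀ s ∈ Icc (0 : ℝ) 1, x + s • (r / 2) • n ∈ B := by
    rintro x hx s ⟨hs0, hs1⟩
    rw [hW, Metric.mem_ball, dist_eq_norm] at hx
    rw [hB, Metric.mem_ball, dist_eq_norm, add_sub_right_comm]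
    have h1 := norm_add_le (x - z) (s • (r / 2) • n)
    rw [norm_smul s, hhn, Real.norm_of_nonneg hs0] at h1
    nlinarith
  have hmem : ∀ f : Plane → ℝ, MemLp f 2 (volume.restrict Ω) →
      MemLp (Ω.indicator f) 2 (volume.restrict B) := fun f hf =>
    ((memLp_indicator_iff_restrict hΩ.measurableSet).2 hf).restrict B
  have h1 := integral_sq_le_translate (U := B) (W := W) Metric.isOpen_ball
    measure_ball_lt_top.ne Metric.isOpen_ball (hmem u huv.memLp)
    (fun i => hmem _ (huv.memLp_grad i))
    (fun i => huv.hasWeakPartial_indicator hΩ Metric.isOpen_ball hfr i) ((r / 2) • n) hWB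
  have h2 : ∫ z in W, Ω.indicator u (z + (r / 2) • n) ^ 2 = 0 := by
    refine setIntegral_eq_zero_of_forall_eq_zero fun x hx => ?_
    have h3 : x + (r / 2) • n ∉ Ω := by
      rw [hU _ (by simpa using hWB x hx 1 (by simp)), not_lt, add_sub_right_comm, inner_add_left,
        real_inner_smul_left, real_inner_self_eq_norm_sq, hn]
      rw [hW, Metric.mem_ball, dist_eq_norm] at hx
      have h4 := abs_real_inner_le_norm (x - z) n
      rw [hn, mul_one] at h4
      have h5 := (abs_le.1 h4).1
      linarith
    simp [h3]
  have h3 : ∫ z in W, Ω.indicator u z ^ 2 = ∫ z in Ω ∩ W, u z ^ 2 := by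
    rw [inter_comm, ← setIntegral_indicator hΩ.measurableSet]
    refine integral_congr_ae (Filter.Eventually.of_forall fun x => ?_)
    by_cases hx : x ∈ Ω <;> simp [hx]
  have h4 : ∫ z in B, ∑ i, Ω.indicator (v i) z ^ 2 ≤ ∫ z in Ω, ∑ i, v i z ^ 2 := by
    have h5 : ∀ z, ∑ i, Ω.indicator (v i) z ^ 2 = Ω.indicator (fun z => ∑ i, v i z ^ 2) z := by
      intro z
      by_cases hz : z ∈ Ω <;> simp [hz]
    simp only [h5]
    rw [setIntegral_indicator hΩ.measurableSet]
    exact setIntegral_mono_set (integrable_finsetSum _ fun i _ => (huv.memLp_grad i).integrable_sq)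
      (Filter.Eventually.of_forall fun z => Finset.sum_nonneg fun i _ => sq_nonneg _)
      inter_subset_right.eventuallyLE
  rw [h2, h3] at h1
  nlinarith [sq_nonneg ‖(r / 2) • n‖]

/-- The set `G` of points with a good neighbourhood is open and meets `Ω` near an inflow point. It
is relatively closed in `Ω` by short translations, hence contains `Ω`. One translation along the
bisector then reaches each boundary point. -/
theorem friedrichs {Ω : Set Plane} (hΩ : IsPolygonalDomain Ω) (hne : (inflow Ω).Nonempty) :
    ∃ C, 0 ≤ C ∧ ∀ u v, IsAdmissible Ω u v →
      ∫ z in Ω, u z ^ 2 ≤ C * ∫ z in Ω, ∑ i, v i z ^ 2 := by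
  have hfin : volume Ω ≠ ⊤ := hΩ.isBounded.measure_lt_top.ne
  set G : Set Plane := {z | ∃ ε > 0, HasFriedrichsBound Ω (Metric.ball z ε)} with hG
  have hsubball : ∀ {z y : Plane} {ε : ℝ}, y ∈ Metric.ball z ε →
      Metric.ball y (ε - dist y z) ⊆ Metric.ball z ε := fun {z y ε} _ =>
    Metric.ball_subset_ball' (by linarith)
  have hmemG : ∀ {z y : Plane} {ε : ℝ}, HasFriedrichsBound Ω (Metric.ball z ε) →
      y ∈ Metric.ball z ε → y ∈ G := fun {z y ε} hb hy =>
    ⟨ε - dist y z, sub_pos.2 hy, hb.mono (hsubball hy)⟩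
  have hGo : IsOpen G := by
    rw [Metric.isOpen_iff]
    rintro z ⟨ε, hε, hb⟩
    exact ⟨ε, hε, fun y hy => hmemG hb hy⟩
  -- moving a good neighbourhood along a translation
  have hmove : ∀ z h : Plane, z + h ∈ G → (∃ ε > 0, ∀ x ∈ Ω ∩ Metric.ball z ε,
      ∀ s ∈ Icc (0 : ℝ) 1, x + s • h ∈ Ω) → z ∈ G := by
    rintro z h ⟨ε', hε', hb⟩ ⟨ε, hε, hx⟩
    refine ⟨min ε ε', lt_min hε hε', hb.translate hΩ.isOpen hfin Metric.isOpen_ball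
      Metric.isOpen_ball h ?_ ?_⟩
    · rintro x ⟨hxΩ, hxb⟩
      exact hx x ⟨hxΩ, Metric.ball_subset_ball (min_le_left _ _) hxb⟩
    · rintro x ⟨-, hxb⟩
      have := Metric.ball_subset_ball (min_le_right _ _) hxb
      simpa [Metric.mem_ball] using this
  have hΩG : Ω ⊆ G := by
    refine hΩ.isConnected.isPreconnected.subset_of_closure_inter_subset hGo ?_ ?_
    · obtain ⟨z, hz⟩ := hne
      obtain ⟨ε, hε, hb⟩ := exists_friedrichs_ball_of_mem_inflow hΩ.isOpen hz
      obtain ⟨n, hn, -⟩ := hz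
      obtain ⟨y, hy, hyΩ⟩ := mem_closure_iff.1 hn.1.1 _ Metric.isOpen_ball
        (Metric.mem_ball_self hε)
      exact ⟨y, hyΩ, hmemG hb hy⟩
    · rintro z ⟨hzG, hzΩ⟩
      obtain ⟨r, hr, hball⟩ := Metric.isOpen_iff.1 hΩ.isOpen z hzΩ
      obtain ⟨y, hy, hyG⟩ := mem_closure_iff.1 hzG _ Metric.isOpen_ball
        (Metric.mem_ball_self (half_pos hr))
      refine hmove z (y - z) (by simpa using hyG) ⟨r / 2, half_pos hr, ?_⟩
      rintro x ⟨-, hx⟩ s ⟨hs0, hs1⟩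
      apply hball
      rw [Metric.mem_ball, dist_eq_norm] at hx hy ⊢
      have h1 := norm_add_le (x - z) (s • (y - z))
      rw [norm_smul, Real.norm_of_nonneg hs0] at h1
      rw [add_sub_right_comm]
      nlinarith [norm_nonneg (y - z)]
  have hcG : closure Ω ⊆ G := by
    intro z hz
    by_cases hzΩ : z ∈ Ω
    · exact hΩG hzΩ
    · obtain ⟨h, hzh, ε, hε, hx⟩ := hΩ.exists_translation
        (z := z) (by rw [hΩ.isOpen.frontier_eq]; exact ⟨hz, hzΩ⟩)
      exact hmove z h (hΩG hzh) ⟨ε, hε, hx⟩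
  -- Finitely many good balls cover the closure, and their constants add up.
  have hcomp : IsCompact (closure Ω) := hΩ.isBounded.isCompact_closure
  have hb : HasFriedrichsBound Ω (closure Ω) := by
    refine hcomp.induction_on (p := HasFriedrichsBound Ω) ⟨0, le_rfl, fun u v _ => by simp⟩
      (fun s t hst ht => ht.mono hst) (fun s t hs ht => hs.union ht) fun z hz => ?_
    obtain ⟨ε, hε, hb⟩ := hcG hz
    exact ⟨Metric.ball z ε, mem_nhdsWithin_of_mem_nhds (Metric.ball_mem_nhds z hε), hb⟩
  rwa [HasFriedrichsBound, inter_eq_left.2 subset_closure] at hb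

/-! ### Triangles -/

lemma abs_apply_le_norm (z : Plane) (i : Fin 2) : |z i| ≤ ‖z‖ :=
  PiLp.norm_apply_le z i

/-- A triangle has an edge `d` at least as high as the inradius; its normal exists on a set of
positive length. -/
lemma IsOpenTriangle.exists_edge {T : Set Plane} (hT : IsOpenTriangle T) :
    ∃ d n : Plane, 0 < d 1 ∧ inradius T ≤ d 1 ∧ ‖d‖ ≤ Metric.diam T ∧
      n 0 ^ 2 * ‖d‖ ^ 2 = d 1 ^ 2 ∧ 0 < Measure.hausdorffMeasure 1 {z | IsOutwardNormal T z n} := by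
  obtain ⟨v, hv, rfl⟩ := hT
  set b : AffineBasis (Fin 3) ℝ Plane := ⟨v, hv, by
    rw [hv.affineSpan_eq_top_iff_card_eq_finrank_add_one]; simp⟩ with hb
  have hbv : ∀ i, b i = v i := fun _ => rfl
  have hbc : ∀ i j, b.coord i (v j) = if i = j then 1 else 0 := fun i j => b.coord_apply i j
  have hT : interior (convexHull ℝ (range v)) = {x | ∀ i, 0 < b.coord i x} :=
    b.interior_convexHull
  have hne : (interior (convexHull ℝ (range v))).Nonempty :=
    ⟨_, b.centroid_mem_interior_convexHull⟩
  set T := interior (convexHull ℝ (range v)) with hTdef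
  -- The edge joins a lowest vertex to a highest one, so its vertical extent is that of the whole
  -- triangle.
  obtain ⟨i, hi⟩ := Finite.exists_max fun i => v i 1
  obtain ⟨j, hj⟩ := Finite.exists_min fun i => v i 1
  have hproj : IsLinearMap ℝ fun x : Plane => x 1 := ⟨fun _ _ => rfl, fun _ _ => rfl⟩
  have hle : convexHull ℝ (range v) ⊆ {x | x 1 ≤ v i 1} :=
    convexHull_min (by rintro _ ⟨l, rfl⟩; exact hi l) (convex_halfSpace_le hproj _)
  have hge : convexHull ℝ (range v) ⊆ {x | v j 1 ≤ x 1} :=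
    convexHull_min (by rintro _ ⟨l, rfl⟩; exact hj l) (convex_halfSpace_ge hproj _)
  have hd0 : 0 ≤ (v i - v j) 1 := sub_nonneg.2 (hj i)
  have hrad : ∀ r : ℝ, ∀ c, Metric.ball c r ⊆ T → r ≤ (v i - v j) 1 := by
    intro r c hc
    by_contra! hr
    -- `s` lies strictly between the height of the triangle and `r`, so a vertical segment of length
    -- `s` fits in the ball but not in the triangle.
    set s := ((v i - v j) 1 + r) / 2 with hs
    have hs0 : 0 < s := by linarith
    have h1 : c ∈ T := hc (Metric.mem_ball_self (by linarith))
    have h2 : c + EuclideanSpace.single 1 s ∈ T := hc (by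
      rw [Metric.mem_ball, dist_eq_norm, add_sub_cancel_left, PiLp.norm_single,
        Real.norm_of_nonneg hs0.le]
      linarith)
    have h3 := hge (interior_subset h1)
    have h4 := hle (interior_subset h2)
    simp at h3 h4 hs hr
    linarith
  have hdpos : 0 < (v i - v j) 1 := by
    obtain ⟨c, hc⟩ := hne
    obtain ⟨r, hr, hball⟩ := Metric.isOpen_iff.1 isOpen_interior c hc
    exact hr.trans_le (hrad r c hball)
  have hij : i ≠ j := by
    rintro rfl
    simp at hdpos
  obtain ⟨k, hki, hkj, hall⟩ : ∃ k, k ≠ i ∧ k ≠ j ∧ ∀ l, l = i ∨ l = j ∨ l = k := by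
    have : ∀ i j : Fin 3, i ≠ j → ∃ k, k ≠ i ∧ k ≠ j ∧ ∀ l, l = i ∨ l = j ∨ l = k := by decide
    exact this i j hij
  -- The gradient of the barycentric coordinate of the third vertex. This coordinate vanishes on the
  -- edge and is positive inside, so the outward normal is `-g / ‖g‖`.
  set g : Plane := (InnerProductSpace.toDual ℝ Plane).symm
    (LinearMap.toContinuousLinearMap (b.coord k).linear) with hg
  have hgL : ∀ x, inner ℝ g x = (b.coord k).linear x := fun x => by
    rw [hg, InnerProductSpace.toDual_symm_apply]; rfl
  have hgc : ∀ x y, inner ℝ g (x - y) = b.coord k x - b.coord k y := fun x y => by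
    rw [hgL]; exact (b.coord k).linearMap_vsub x y
  have hgd : inner ℝ g (v i - v j) = 0 := by
    rw [hgc, hbc, hbc, if_neg hki, if_neg hkj, sub_zero]
  have hg0 : g ≠ 0 := by
    intro h
    have h1 := hgc (v k) (v i)
    rw [hbc, hbc, if_pos rfl, if_neg hki, h, inner_zero_left] at h1
    norm_num at h1
  have hgn : 0 < ‖g‖ := norm_pos_iff.2 hg0
  set n : Plane := -(‖g‖⁻¹ • g) with hn
  have hn1 : ‖n‖ = 1 := by
    rw [hn, norm_neg, norm_smul, norm_inv, norm_norm, inv_mul_cancel₀ hgn.ne']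
  have hnd : inner ℝ n (v i - v j) = 0 := by
    rw [hn, inner_neg_left, real_inner_smul_left, hgd, mul_zero, neg_zero]
  have hcc : ∀ l, Continuous (b.coord l) := fun l => (b.coord l).continuous_of_finiteDimensional
  have hedge : ∀ t ∈ Ioo (0 : ℝ) 1, IsOutwardNormal T (AffineMap.lineMap (v j) (v i) t) n := by
    intro t ht
    set z : Plane := AffineMap.lineMap (v j) (v i) t with hz
    have hcz : ∀ l, b.coord l z = AffineMap.lineMap (b.coord l (v j)) (b.coord l (v i)) t :=
      fun l => (b.coord l).apply_lineMap _ _ _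
    have hzi : 0 < b.coord i z := by
      rw [hcz, hbc, hbc, if_neg hij, if_pos rfl]; simpa [AffineMap.lineMap_apply] using ht.1
    have hzj : 0 < b.coord j z := by
      rw [hcz, hbc, hbc, if_neg hij.symm, if_pos rfl]; simpa [AffineMap.lineMap_apply] using ht.2
    have hzk : b.coord k z = 0 := by
      rw [hcz, hbc, hbc, if_neg hkj, if_neg hki]; simp
    have hopen : IsOpen ({x | 0 < b.coord i x} ∩ {x | 0 < b.coord j x}) :=
      (isOpen_lt continuous_const (hcc i)).inter (isOpen_lt continuous_const (hcc j))
    obtain ⟨r, hr, hball⟩ := Metric.isOpen_iff.1 hopen z ⟨hzi, hzj⟩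
    refine isOutwardNormal_of_ball hn1 hr fun ζ hζ => ?_
    have h1 : inner ℝ (ζ - z) n = -(‖g‖⁻¹ * b.coord k ζ) := by
      rw [hn, inner_neg_right, real_inner_smul_right, real_inner_comm, hgc, hzk, sub_zero]
    rw [h1, neg_lt_zero, mul_pos_iff_of_pos_left (inv_pos.2 hgn), hT]
    refine ⟨fun h => h k, fun h l => ?_⟩
    rcases hall l with rfl | rfl | rfl
    · exact (hball hζ).1
    · exact (hball hζ).2
    · exact h
  refine ⟨v i - v j, n, hdpos, ?_, ?_, ?_, ?_⟩
  · refine csSup_le ⟨0, le_rfl, 0, by simp⟩ ?_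
    rintro r ⟨-, c, hc⟩
    exact hrad r c hc
  · have hcl : ∀ l, v l ∈ closure T := fun l => by
      rw [hTdef, (convex_convexHull ℝ _).closure_interior_eq_closure_of_nonempty_interior hne]
      exact subset_closure (subset_convexHull ℝ _ ⟨l, rfl⟩)
    have hbd : Bornology.IsBounded T :=
      (isBounded_convexHull.2 (finite_range v).isBounded).subset interior_subset
    rw [← dist_eq_norm, ← Metric.diam_closure]
    exact Metric.dist_le_diam_of_mem hbd.closure (hcl i) (hcl j)
  · have h1 := norm_sq_plane n
    rw [inner_plane] at hnd
    rw [hn1] at h1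
    rw [norm_sq_plane]
    have h2 : n 0 * (v i - v j) 0 = -(n 1 * (v i - v j) 1) := by linarith
    have h3 : (n 0 * (v i - v j) 0) ^ 2 = (n 1 * (v i - v j) 1) ^ 2 := by rw [h2]; ring
    nlinarith
  · have hlip : LipschitzWith 1 (fun z : Plane => z 1) := LipschitzWith.of_dist_le_mul fun x y => by
      rw [NNReal.coe_one, one_mul, Real.dist_eq, dist_eq_norm]
      exact abs_apply_le_norm (x - y) 1
    have h1 := hlip.hausdorffMeasure_image_le (d := 1) zero_le_one {z | IsOutwardNormal T z n}
    rw [hausdorffMeasure_real] at h1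
    have h2 : Ioo (v j 1) (v i 1) ⊆ (fun z : Plane => z 1) '' {z | IsOutwardNormal T z n} := by
      rintro y ⟨hy1, hy2⟩
      have hD : 0 < v i 1 - v j 1 := hdpos
      refine ⟨AffineMap.lineMap (v j) (v i) ((y - v j 1) / (v i 1 - v j 1)),
        hedge _ ⟨div_pos (by linarith) hD, (div_lt_one hD).2 (by linarith)⟩, ?_⟩
      simp only [AffineMap.lineMap_apply, vsub_eq_sub, vadd_eq_add, PiLp.add_apply,
        PiLp.smul_apply, PiLp.sub_apply, smul_eq_mul]
      rw [div_mul_cancel₀ _ hD.ne']; ring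
    have h3 : 0 < volume (Ioo (v j 1) (v i 1)) := by
      rw [Real.volume_Ioo, ENNReal.ofReal_pos]; exact hdpos
    have h4 := h3.trans_le ((measure_mono h2).trans h1)
    simpa using h4

lemma IsOpenTriangle.diam_pos {T : Set Plane} (hT : IsOpenTriangle T) : 0 < Metric.diam T := by
  obtain ⟨d, -, hd, -, hdd, -⟩ := hT.exists_edge
  exact hd.trans_le (((le_abs_self _).trans (abs_apply_le_norm d 1)).trans hdd)

lemma IsOpenTriangle.isOpen {T : Set Plane} (hT : IsOpenTriangle T) : IsOpen T := by
  obtain ⟨v, -, rfl⟩ := hT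
  exact isOpen_interior

lemma IsOpenTriangle.volume_frontier {T : Set Plane} (hT : IsOpenTriangle T) :
    volume (frontier T) = 0 := by
  obtain ⟨v, -, rfl⟩ := hT
  exact (convex_convexHull ℝ _).interior.addHaar_frontier volume

/-! ### Integration over a triangulation -/

lemma IsTriangulation.subset {Ω : Set Plane} {𝒯 : Finset (Set Plane)} (hΩ : IsPolygonalDomain Ω)
    (h : IsTriangulation Ω 𝒯) {T : Set Plane} (hT : T ∈ 𝒯) : T ⊆ Ω := by
  rw [← hΩ.interior_closure]
  refine interior_maximal ?_ (h.isOpenTriangle T hT).isOpen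
  rw [← h.cover]
  exact subset_closure.trans (subset_biUnion_of_mem (u := fun T => closure T) hT)

/-- The open elements miss only points of `Ω` on their frontiers, which are null since triangles are
convex. -/
lemma IsTriangulation.sum_integral {Ω : Set Plane} {𝒯 : Finset (Set Plane)}
    (hΩ : IsPolygonalDomain Ω) (h : IsTriangulation Ω 𝒯) {f : Plane → ℝ}
    (hf : IntegrableOn f Ω) : ∑ T ∈ 𝒯, ∫ z in T, f z = ∫ z in Ω, f z := by
  rw [← integral_biUnion_finset 𝒯 (fun T hT => (h.isOpenTriangle T hT).isOpen.measurableSet)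
    (fun T hT T' hT' hne => h.disjoint T hT T' hT' hne)
    (fun T hT => hf.mono_set (h.subset hΩ hT))]
  have hsub : (⋃ T ∈ 𝒯, T) ⊆ Ω := iUnion₂_subset fun T hT => h.subset hΩ hT
  have hnull : volume (⋃ T ∈ 𝒯, frontier T) = 0 :=
    (measure_biUnion_null_iff 𝒯.countable_toSet).2 fun T hT =>
      (h.isOpenTriangle T hT).volume_frontier
  refine setIntegral_congr_set ?_
  refine Filter.EventuallyLE.antisymm hsub.eventuallyLE ?_
  filter_upwards [measure_eq_zero_iff_ae_notMem.1 hnull] with z hz hzΩ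
  have h1 : z ∈ ⋃ T ∈ 𝒯, closure T := h.cover ▸ subset_closure hzΩ
  obtain ⟨T, hT, hzT⟩ := mem_iUnion₂.1 h1
  refine mem_iUnion₂.2 ⟨T, hT, ?_⟩
  by_contra hzT'
  refine hz (mem_iUnion₂.2 ⟨T, hT, ?_⟩)
  rw [(h.isOpenTriangle T hT).isOpen.frontier_eq]
  exact ⟨hzT, hzT'⟩

lemma IsTriangulation.nonempty {Ω : Set Plane} {𝒯 : Finset (Set Plane)}
    (hΩ : IsPolygonalDomain Ω) (h : IsTriangulation Ω 𝒯) : 𝒯.Nonempty := by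
  obtain ⟨z, hz⟩ := hΩ.isConnected.nonempty
  have h1 : z ∈ ⋃ T ∈ 𝒯, closure T := h.cover ▸ subset_closure hz
  obtain ⟨T, hT, -⟩ := mem_iUnion₂.1 h1
  exact ⟨T, hT⟩

lemma hMin_le {𝒯 : Finset (Set Plane)} {T : Set Plane} (hT : T ∈ 𝒯) :
    hMin 𝒯 ≤ Metric.diam T :=
  ciInf_le (finite_range fun T : 𝒯 => Metric.diam (T : Set Plane)).bddBelow ⟨T, hT⟩

lemma le_hMax {𝒯 : Finset (Set Plane)} {T : Set Plane} (hT : T ∈ 𝒯) :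
    Metric.diam T ≤ hMax 𝒯 :=
  le_ciSup (finite_range fun T : 𝒯 => Metric.diam (T : Set Plane)).bddAbove ⟨T, hT⟩

lemma IsTriangulation.hMin_pos {Ω : Set Plane} {𝒯 : Finset (Set Plane)}
    (hΩ : IsPolygonalDomain Ω) (h : IsTriangulation Ω 𝒯) : 0 < hMin 𝒯 := by
  have : Nonempty 𝒯 := (h.nonempty hΩ).to_subtype
  obtain ⟨T, hT⟩ := exists_eq_ciInf_of_finite (f := fun T : 𝒯 => Metric.diam (T : Set Plane))
  rw [hMin, ← hT]
  exact (h.isOpenTriangle T T.2).diam_pos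

/-! ### Bounds for the parameters -/

lemma toReal_eLpNorm_top_le {X : Type*} [MeasurableSpace X] {μ : Measure X} {f : X → ℝ} {C : ℝ}
    (hC : 0 ≤ C) (hf : ∀ᵐ x ∂μ, |f x| ≤ C) : (eLpNorm f ∞ μ).toReal ≤ C := by
  rw [eLpNorm_exponent_top]
  exact ENNReal.toReal_le_of_le_ofReal hC (eLpNormEssSup_le_of_ae_bound hf)

lemma le_toReal_eLpNorm_top {X : Type*} [MeasurableSpace X] {μ : Measure X} {f : X → ℝ} {c C : ℝ}
    (hf : ∀ᵐ x ∂μ, |f x| ≤ C) {S : Set X} (hS : 0 < μ S) (hc : ∀ x ∈ S, c ≤ |f x|) :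
    c ≤ (eLpNorm f ∞ μ).toReal := by
  -- Needed because `toReal` sends `⊤` to `0`.
  have hfin : eLpNorm f ∞ μ ≠ ⊤ := by
    rw [eLpNorm_exponent_top]
    exact ((eLpNormEssSup_le_of_ae_bound hf).trans_lt ENNReal.ofReal_lt_top).ne
  by_contra! hlt
  refine hS.ne' (measure_mono_null ?_ (ae_le_eLpNormEssSup (f := f) (μ := μ)))
  intro x hx
  change ¬ (‖f x‖ₑ ≤ eLpNormEssSup f μ)
  rw [not_le, ← eLpNorm_exponent_top, ← ENNReal.ofReal_toReal hfin, ← ofReal_norm]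
  refine (ENNReal.ofReal_lt_ofReal_iff ?_).2 (hlt.trans_le (hc x hx))
  exact (ENNReal.toReal_nonneg.trans_lt hlt).trans_le (hc x hx)

/-- The `n₁` term alone suffices: on the edge `d` of `IsOpenTriangle.exists_edge`, `|n₁| = d₂ / ‖d‖
≥ ρ_T / h_T ≥ σ`, on a set of positive length. -/
lemma le_cDelta {T : Set Plane} (hT : IsOpenTriangle T) {σ Cinv : ℝ} (hσ : 0 < σ)
    (hreg : σ * Metric.diam T ≤ inradius T) : Cinv ^ 2 * σ ^ 2 / 3 ≤ cDelta Cinv T := by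
  obtain ⟨d, n, hd, hrad, hdiam, hn, hpos⟩ := hT.exists_edge
  have hdn : 0 < ‖d‖ := hd.trans_le ((le_abs_self _).trans (abs_apply_le_norm d 1))
  have hσn : σ ≤ |n 0| := by
    have h1 : σ * ‖d‖ ≤ d 1 := (mul_le_mul_of_nonneg_left hdiam hσ.le).trans (hreg.trans hrad)
    have h2 : (|n 0| * ‖d‖) ^ 2 = d 1 ^ 2 := by rw [mul_pow, sq_abs, hn]
    have h3 : |n 0| * ‖d‖ = d 1 :=
      (sq_eq_sq₀ (mul_nonneg (abs_nonneg _) hdn.le) hd.le).1 h2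
    exact le_of_mul_le_mul_right (h1.trans_eq h3.symm) hdn
  have hnorm : σ ≤ (eLpNorm (fun z => outwardNormal T z 0) ∞ (bdry T)).toReal := by
    refine le_toReal_eLpNorm_top (C := 1) (S := {z | IsOutwardNormal T z n})
      (Filter.Eventually.of_forall fun z =>
        (abs_apply_le_norm _ 0).trans (norm_outwardNormal_le T z)) ?_ ?_
    · rwa [bdry, Measure.restrict_eq_self _ (fun z hz => hz.1)]
    · intro z hz
      rw [hz.outwardNormal_eq]
      exact hσn
  rw [cDelta]
  have h1 : σ ^ 2 ≤ (eLpNorm (fun z => outwardNormal T z 0) ∞ (bdry T)).toReal ^ 2 := by gcongr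
  have h2 : 0 ≤ (eLpNorm (fun z : Plane => z 0 * outwardNormal T z 1) ∞
        ((bdry T).restrict (elemInflow T))).toReal := ENNReal.toReal_nonneg
  nlinarith [mul_nonneg (sq_nonneg Cinv) h2, mul_le_mul_of_nonneg_left h1 (sq_nonneg Cinv)]

lemma cDelta_le {T : Set Plane} {R Cinv : ℝ} (hR : 0 ≤ R) (hTR : ∀ z ∈ closure T, ‖z‖ ≤ R) :
    cDelta Cinv T ≤ Cinv ^ 2 / 6 * (3 * R + 2) := by
  have hmem : ∀ᵐ z ∂(bdry T), z ∈ frontier T := ae_restrict_mem isClosed_frontier.measurableSet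
  have h1 : (eLpNorm (fun z : Plane => z 0 * outwardNormal T z 1) ∞
      ((bdry T).restrict (elemInflow T))).toReal ≤ R := by
    refine toReal_eLpNorm_top_le hR ?_
    filter_upwards [ae_restrict_of_ae hmem] with z hz
    rw [abs_mul, ← mul_one R]
    exact mul_le_mul ((abs_apply_le_norm z 0).trans (hTR z hz.1))
      ((abs_apply_le_norm _ 1).trans (norm_outwardNormal_le T z)) (abs_nonneg _) hR
  have h2 : (eLpNorm (fun z => outwardNormal T z 0) ∞ (bdry T)).toReal ≤ 1 :=
    toReal_eLpNorm_top_le zero_le_one (Filter.Eventually.of_forall fun z =>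
      (abs_apply_le_norm _ 0).trans (norm_outwardNormal_le T z))
  have h3 : (eLpNorm (fun z => outwardNormal T z 0) ∞ (bdry T)).toReal ^ 2 ≤ 1 :=
    pow_le_one₀ ENNReal.toReal_nonneg h2
  rw [cDelta]
  gcongr
  linarith

lemma quadA_eq {δ : ℝ} (v : Fin 2 → ℝ) : quadA δ v =
    alpha δ * v 0 ^ 2 + 2 * beta δ * v 0 * v 1 + gamma δ * v 1 ^ 2 := by
  simp [quadA, matA, Matrix.mulVec, dotProduct, Fin.sum_univ_two]
  ring

lemma quadA_nonneg {δ : ℝ} (hδ : 0 < δ) (v : Fin 2 → ℝ) : 0 ≤ quadA δ v := by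
  -- Completing the square leaves `α - β² / γ = 1/(8δ) - 1/(9δ) = 1/(72δ) > 0`.
  have h : quadA δ v = 1 / (64 * δ) * (v 1 / δ + 8 / 3 * v 0) ^ 2 + 1 / (72 * δ) * v 0 ^ 2 := by
    rw [quadA_eq, alpha, beta, gamma]
    field_simp
    ring
  rw [h]
  positivity

lemma quadA_le {a δ : ℝ} (ha : 0 < a) (hδ : a ≤ δ) (v : Fin 2 → ℝ) :
    quadA δ v ≤ (1 / (4 * a) + 1 / (32 * a ^ 3)) * ∑ i, v i ^ 2 := by
  have hδ0 : 0 < δ := ha.trans_le hδ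
  -- `A ≤ 2 diag(α, γ)`: the difference is the form of `A` with the sign of `β` reversed, so it is
  -- also positive.
  have h : 1 / (4 * δ) * v 0 ^ 2 + 1 / (32 * δ ^ 3) * v 1 ^ 2 - quadA δ v =
      1 / (64 * δ) * (v 1 / δ - 8 / 3 * v 0) ^ 2 + 1 / (72 * δ) * v 0 ^ 2 := by
    rw [quadA_eq, alpha, beta, gamma]
    field_simp
    ring
  have h0 : 0 ≤ 1 / (64 * δ) * (v 1 / δ - 8 / 3 * v 0) ^ 2 + 1 / (72 * δ) * v 0 ^ 2 := by positivity
  have h1 : 1 / (4 * δ) ≤ 1 / (4 * a) := by gcongr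
  have h2 : 1 / (32 * δ ^ 3) ≤ 1 / (32 * a ^ 3) := by gcongr
  have h3 : 0 ≤ 1 / (4 * a) := by positivity
  have h4 : 0 ≤ 1 / (32 * a ^ 3) := by positivity
  rw [Fin.sum_univ_two]
  nlinarith [mul_le_mul_of_nonneg_right h1 (sq_nonneg (v 0)),
    mul_le_mul_of_nonneg_right h2 (sq_nonneg (v 1)), mul_nonneg h3 (sq_nonneg (v 1)),
    mul_nonneg h4 (sq_nonneg (v 0))]

lemma le_delta {T : Set Plane} (hT : IsOpenTriangle T) {σ Cinv : ℝ} (hσ : 0 < σ)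
    (hreg : σ * Metric.diam T ≤ inradius T) (hdiam : Metric.diam T < 1) {p : ℕ} (hp : 1 ≤ p) :
    Cinv ^ 2 * σ ^ 2 / 3 ≤ delta Cinv p T := by
  have h1 := le_cDelta (Cinv := Cinv) hT hσ hreg
  have h2 := hT.diam_pos
  have hp1 : (1 : ℝ) ≤ (p : ℝ) ^ 4 := one_le_pow₀ (by exact_mod_cast hp)
  have h0 : 0 ≤ Cinv ^ 2 * σ ^ 2 / 3 := by positivity
  rw [delta, le_div_iff₀ (by positivity)]
  have h3 : Metric.diam T ^ 2 ≤ 1 := pow_le_one₀ h2.le hdiam.le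
  calc _ ≤ Cinv ^ 2 * σ ^ 2 / 3 * 1 := by gcongr
    _ ≤ cDelta Cinv T * (p : ℝ) ^ 4 := mul_le_mul h1 hp1 zero_le_one (h0.trans h1)

lemma gamma_mul_delta_ge {T : Set Plane} {Cinv b h : ℝ} {p : ℕ} (hp : 1 ≤ p)
    (hb : 0 < b) (hT : cDelta Cinv T ≤ b) (hh : 0 < h) (hhT : h ≤ Metric.diam T)
    (hδ : 0 < delta Cinv p T) :
    1 / (64 * b ^ 2) * (h ^ 4 / (p : ℝ) ^ 8) ≤ gamma (delta Cinv p T) * delta Cinv p T := by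
  have hp0 : (0 : ℝ) < p := by exact_mod_cast hp
  have h1 : delta Cinv p T ≤ b * (p : ℝ) ^ 4 / h ^ 2 := by
    rw [delta]; gcongr
  have h2 : gamma (delta Cinv p T) * delta Cinv p T = 1 / (64 * delta Cinv p T ^ 2) := by
    rw [gamma]; field_simp
  have h3 : 1 / (64 * b ^ 2) * (h ^ 4 / (p : ℝ) ^ 8) = 1 / (64 * (b * (p : ℝ) ^ 4 / h ^ 2) ^ 2) := by
    field_simp
  rw [h2, h3]
  gcongr

/-! ### The spectral gap at a fixed time -/

lemma isAdmissible_of_mem {Ω : Set Plane} {𝒯 : Finset (Set Plane)} {u : Jet Ω}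
    (hu : u ∈ H1BrokenH2 Ω 𝒯) (h0 : VanishesOnInflow u) : IsAdmissible Ω (val u) (grad u) where
  memLp := Lp.memLp _
  memLp_grad _ := Lp.memLp _
  hasWeakPartial := hu.1
  trace := h0

/-- Only the sign of the integrand counts, so neither existence nor regularity of the traces
matters: a non-integrable integrand has integral `0`. -/
lemma boundary_term_nonneg {U S : Set Plane} {f : Plane → ℝ} (hf : ∀ z, 0 ≤ f z)
    (hS : ∀ z ∈ S, ∃ n, IsOutwardNormal U z n ∧ 0 ≤ z 0 * n 1) :
    0 ≤ ∫ z, S.indicator (fun z => z 0 * outwardNormal U z 1 * f z) z ∂(bdry U) := by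
  refine integral_nonneg fun z => indicator_nonneg (fun z hz => ?_) z
  obtain ⟨n, hn, h⟩ := hS z hz
  rw [hn.outwardNormal_eq]
  exact mul_nonneg h (hf z)

lemma integrable_grad_sq {Ω : Set Plane} (u : Jet Ω) :
    IntegrableOn (fun z => ∑ i, grad u i z ^ 2) Ω :=
  integrable_finsetSum _ fun _ _ => (Lp.memLp _).integrable_sq

lemma normASq_le {Ω : Set Plane} (hΩ : IsPolygonalDomain Ω) {𝒯 : Finset (Set Plane)}
    (h𝒯 : IsTriangulation Ω 𝒯) {a C Cinv : ℝ} (ha : 0 < a) {p : ℕ}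
    (hδ : ∀ T ∈ 𝒯, a ≤ delta Cinv p T) (u : Jet Ω)
    (hC : ∫ z in Ω, val u z ^ 2 ≤ C * ∫ z in Ω, ∑ i, grad u i z ^ 2) :
    normASq 𝒯 Cinv p u ≤
      (C + (1 / (4 * a) + 1 / (32 * a ^ 3))) * ∫ z in Ω, ∑ i, grad u i z ^ 2 := by
  rw [normASq, add_mul]
  refine add_le_add hC ?_
  rw [← h𝒯.sum_integral hΩ (integrable_grad_sq u), Finset.mul_sum]
  refine Finset.sum_le_sum fun T hT => ?_
  rw [← integral_const_mul]
  refine integral_mono_of_nonneg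
    (Filter.Eventually.of_forall fun z => quadA_nonneg (ha.trans_le (hδ T hT)) _)
    (((integrable_grad_sq u).mono_set (h𝒯.subset hΩ hT)).const_mul _)
    (Filter.Eventually.of_forall fun z => quadA_le ha (hδ T hT) _)

lemma le_stabNormSq {Ω : Set Plane} (hΩ : IsPolygonalDomain Ω) {𝒯 : Finset (Set Plane)}
    (h𝒯 : IsTriangulation Ω 𝒯) {m Cinv CINV : ℝ} {p : ℕ} (hm : m ≤ 1 / 2)
    (hδ : ∀ T ∈ 𝒯, 0 < delta Cinv p T)
    (hγ : ∀ T ∈ 𝒯, m ≤ gamma (delta Cinv p T) * delta Cinv p T) (u ut : Jet Ω) :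
    m * ∫ z in Ω, ∑ i, grad u i z ^ 2 ≤ stabNormSq 𝒯 Cinv CINV p u ut := by
  have h0 : IntegrableOn (fun z => grad u 0 z ^ 2) Ω := (Lp.memLp _).integrable_sq
  have h1 : IntegrableOn (fun z => grad u 1 z ^ 2) Ω := (Lp.memLp _).integrable_sq
  have e0 : m * ∫ z in Ω, grad u 0 z ^ 2 ≤ 1 / 2 * ∫ z in Ω, grad u 0 z ^ 2 :=
    mul_le_mul_of_nonneg_right hm (integral_nonneg fun z => sq_nonneg _)
  have e1 : m * ∫ z in Ω, grad u 1 z ^ 2 ≤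
      ∑ T ∈ 𝒯, gamma (delta Cinv p T) * delta Cinv p T * (∫ z in T, grad u 1 z ^ 2) := by
    rw [← h𝒯.sum_integral hΩ h1, Finset.mul_sum]
    exact Finset.sum_le_sum fun T hT =>
      mul_le_mul_of_nonneg_right (hγ T hT) (integral_nonneg fun z => sq_nonneg _)
  have e2 : 0 ≤ ∑ T ∈ 𝒯, tau CINV p T * (∫ z in T, (val ut z + z 0 * grad u 1 z) ^ 2) :=
    Finset.sum_nonneg fun T _ => mul_nonneg (by rw [tau]; positivity)
      (integral_nonneg fun z => sq_nonneg _)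
  have e3 : 0 ≤ ∑ T ∈ 𝒯, (∫ z in T, quadA (delta Cinv p T) (fun j => hess u 0 j z)) :=
    Finset.sum_nonneg fun T hT => integral_nonneg fun z => quadA_nonneg (hδ T hT) _
  have e4 : 0 ≤ ∫ z, (outflow Ω).indicator
      (fun z => z 0 * outwardNormal Ω z 1 * trace Ω (val u) (grad u) z ^ 2) z ∂(bdry Ω) :=
    boundary_term_nonneg (fun z => sq_nonneg _) fun z ⟨n, hn, _, h⟩ => ⟨n, hn, h⟩
  have e5 : 0 ≤ ∑ T ∈ 𝒯, (∫ z, (elemOutflow T).indicator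
      (fun z => z 0 * outwardNormal T z 1 *
        quadA (delta Cinv p T) (fun i => trace T (grad u i) (hess u i) z)) z ∂(bdry T)) :=
    Finset.sum_nonneg fun T hT => boundary_term_nonneg (fun z => quadA_nonneg (hδ T hT) _)
      fun z hz => hz
  simp only [Fin.sum_univ_two]
  rw [integral_add h0 h1, stabNormSq]
  linarith

end Kolmogorov

theorem mainTheorem4
    (Ω : Set Kolmogorov.Plane) (hΩ : Kolmogorov.IsPolygonalDomain Ω)
    (hinflow : 0 < MeasureTheory.Measure.hausdorffMeasure 1 (Kolmogorov.inflow Ω))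
    (σ : ℝ) (hσ : 0 < σ) (Cinv : ℝ) (hCinv : 0 < Cinv) :
    ∃ c : ℝ, 0 < c ∧ c < 1 ∧
      ∀ CINV : ℝ, 0 < CINV →
      ∀ 𝒯 : Finset (Set Kolmogorov.Plane), Kolmogorov.IsTriangulation Ω 𝒯 →
        Kolmogorov.IsShapeRegular σ 𝒯 → Kolmogorov.hMax 𝒯 < 1 →
      ∀ p : ℕ, 1 ≤ p →
      ∀ tf : ℝ, 0 < tf →
      ∀ w w' : ℝ → Kolmogorov.Jet Ω,
        Kolmogorov.IsH1Time tf (Kolmogorov.H1BrokenH2 Ω 𝒯) w w' →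
        (∀ᵐ t ∂(MeasureTheory.volume.restrict (Set.Ioc 0 tf)),
          Kolmogorov.VanishesOnInflow (w t)) →
        ∀ᵐ t ∂(MeasureTheory.volume.restrict (Set.Ioc 0 tf)),
          c * Kolmogorov.hMin 𝒯 ^ 4 / (p : ℝ) ^ 8 * Kolmogorov.normASq 𝒯 Cinv p (w t)
            ≤ Kolmogorov.stabNormSq 𝒯 Cinv CINV p (w t) (w' t) := by
  open Kolmogorov in
  have hne : (inflow Ω).Nonempty := nonempty_of_measure_ne_zero hinflow.ne'
  obtain ⟨C, hC0, hC⟩ := friedrichs hΩ hne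
  obtain ⟨R, hR0, hR⟩ : ∃ R : ℝ, 0 ≤ R ∧ ∀ z ∈ closure Ω, ‖z‖ ≤ R := by
    obtain ⟨R, hR0, hR⟩ := hΩ.isBounded.closure.exists_pos_norm_le
    exact ⟨R, hR0.le, hR⟩
  set a : ℝ := Cinv ^ 2 * σ ^ 2 / 3 with ha
  set b : ℝ := Cinv ^ 2 / 6 * (3 * R + 2) with hb
  have ha0 : 0 < a := by positivity
  have hb0 : 0 < b := by positivity
  set K : ℝ := C + (1 / (4 * a) + 1 / (32 * a ^ 3)) with hK
  have hK0 : 0 < K := by positivity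
  -- `1 / 2` is the coefficient of `‖w_x‖²`; `1 / (64 b²)` comes from the lower bound for `γδ`.
  set m : ℝ := min (1 / 2) (1 / (64 * b ^ 2)) with hm
  have hm0 : 0 < m := lt_min (by norm_num) (by positivity)
  -- `m / K` is the ratio of the two comparison constants, and the cut-off at `1 / 2` makes the
  -- result less than `1`.
  refine ⟨min (1 / 2) (m / K), lt_min (by norm_num) (by positivity),
    (min_le_left _ _).trans_lt (by norm_num), ?_⟩
  intro CINV _ 𝒯 h𝒯 hreg hmax p hp tf _ w w' hw hw0
  have hp1 : (1 : ℝ) ≤ p := by exact_mod_cast hp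
  have hdiam : ∀ T ∈ 𝒯, Metric.diam T < 1 := fun T hT => (le_hMax hT).trans_lt hmax
  have hδ : ∀ T ∈ 𝒯, a ≤ delta Cinv p T := fun T hT =>
    le_delta (h𝒯.isOpenTriangle T hT) hσ (hreg T hT) (hdiam T hT) hp
  have hh : 0 < hMin 𝒯 := h𝒯.hMin_pos hΩ
  have hh1 : hMin 𝒯 ≤ 1 := by
    obtain ⟨T, hT⟩ := h𝒯.nonempty hΩ
    exact (hMin_le hT).trans (hdiam T hT).le
  set H : ℝ := hMin 𝒯 ^ 4 / (p : ℝ) ^ 8 with hH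
  have hH0 : 0 < H := by positivity
  -- Thus `m * H ≤ 1 / 2`, and one factor `m * H` serves both partial derivatives.
  have hH1 : H ≤ 1 := (div_le_one (by positivity)).2
    ((pow_le_one₀ hh.le hh1).trans (one_le_pow₀ hp1))
  have hγ : ∀ T ∈ 𝒯, m * H ≤ gamma (delta Cinv p T) * delta Cinv p T := fun T hT =>
    (mul_le_mul_of_nonneg_right (min_le_right _ _) hH0.le).trans
      (gamma_mul_delta_ge hp hb0 (cDelta_le hR0 fun z hz =>
        hR z (closure_mono (h𝒯.subset hΩ hT) hz)) hh (hMin_le hT) (ha0.trans_le (hδ T hT)))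
  have hmH : m * H ≤ 1 / 2 :=
    (mul_le_mul (min_le_left _ _) hH1 hH0.le (by norm_num)).trans_eq (by norm_num)
  filter_upwards [hw.mem, hw0] with t ht ht0
  have hN := normASq_le hΩ h𝒯 ha0 hδ (w t) (hC _ _ (isAdmissible_of_mem ht ht0))
  have hS := le_stabNormSq (CINV := CINV) hΩ h𝒯 hmH (fun T hT => ha0.trans_le (hδ T hT)) hγ
    (w t) (w' t)
  set D : ℝ := ∫ z in Ω, ∑ i, grad (w t) i z ^ 2 with hD
  have hD0 : 0 ≤ D := integral_nonneg fun z => Finset.sum_nonneg fun i _ => sq_nonneg _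
  have hc : min (1 / 2) (m / K) * K ≤ m := (le_div_iff₀ hK0).1 (min_le_right _ _)
  have hc0 : 0 ≤ min (1 / 2) (m / K) := le_min (by norm_num) (by positivity)
  rw [mul_div_assoc]
  calc min (1 / 2) (m / K) * H * normASq 𝒯 Cinv p (w t)
      ≤ min (1 / 2) (m / K) * H * (K * D) := by gcongr
    _ = min (1 / 2) (m / K) * K * (H * D) := by ring
    _ ≤ m * (H * D) := by gcongr
    _ = m * H * D := by ring
    _ ≤ _ := hS
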